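/- Let $\kappa>0$. Let $\mathcal B$ be the space of functions on $\mathbb R^2$ of the form $f(\alpha,\beta)=\frac1{2\pi}\int_{\mathbb R^2}\hat f(u,v)\,e^{-i(\alpha u+\beta v)}\,du\,dv$ with $\hat f\in C_c^\infty(\mathbb R^2)$, equipped with the star product $$(f*g)(\alpha,\beta)=\frac1{2\pi}\int dv\int du\, f(\alpha+u,\beta)\,g(\alpha,e^{-v/\kappa}\beta)\,e^{-iuv}.$$ For $\gamma\in\mathbb R$ let $T_\gamma f$ be the Fourier transform, in the same normalisation, of $\hat f(u,v)e^{\gamma u}$ (formally $(T_\gamma f)(\alpha,\beta)=f(\alpha+i\gamma,\beta)$), and put $P=\partial/\partial\beta$, $\mathcal E^{\pm1}=T_{\pm1/\kappa}$. Let $\Omega^*(\mathcal B)=\bigoplus_k\Omega^k(\mathcal B)$ be the $\kappa$-Poincaré covariant differential calculus: $\Omega^*(\mathcal B)$ consists of the sums $\sum_I\psi_I f_I$ with $f_I\in\mathcal B$ ($\psi_I$ running over the wedge monomials in three anticommuting one-forms $dx,\psi_+,\psi_-$), with product given by the star product and the bimodule rules $$f\,dx=dx\,f+\psi_-\tfrac{i}{\kappa}Pf,\qquad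 f\,\psi_+=\psi_+\,\mathcal E^{-1}f+dx\,\tfrac{2i}{\kappa}\mathcal E^{-1}Pf-\psi_-\tfrac1{\kappa^2}\mathcal E^{-1}P^2f,\qquad f\,\psi_-=\psi_-\,\mathcal Ef,$$ and with exterior derivative $d(\psi_If)=(-1)^{|I|}\psi_I\wedge df$, where $$df=dx\,\mathcal E^{-1}Pf-\tfrac{i\kappa}2\psi_+(\mathcal E^{-1}-1)f+\tfrac12\psi_-\big(\tfrac i\kappa\mathcal E^{-1}P^2+i\kappa(\mathcal E-1)\big)f .$$ Extend $T_\gamma$ to forms by $T_\gamma(\psi_If)=\psi_I\,T_\gamma f$. Then $(\Omega^*(\mathcal B),\wedge,d)$ is a graded differential algebra with $\Omega^0(\mathcal B)=\mathcal B$, the map $T_{1/\kappa}$ is an automorphism of it, every three-form is $(dx\wedge\psi_+\wedge\psi_-)f$ with $f\in\mathcal B$, every $f\in\mathcal B$ is Lebesgue integrable, and the linear functional $\Omega^3(\mathcal B)\to\mathbb C$, $$\int (dx\wedge\psi_+\wedge\psi_-)\,f=\int_{\mathbb R^2}f(\alpha,\beta)\,d\alpha\,d\beta,$$ is a closed graded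 twisted trace: $$\int d\rho=0\quad(\rho\in\Omega^2(\mathcal B)),\qquad \int\omega\wedge\eta=(-1)^{kl}\int T_{1/\kappa}(\eta)\wedge\omega\quad(\omega\in\Omega^k(\mathcal B),\ \eta\in\Omega^l(\mathcal B),\ k+l=3).$$ Thus it defines a three-dimensional cycle over $\mathcal B$ twisted by $T_{1/\kappa}$. -/

import Mathlib

open MeasureTheory

noncomputable section

namespace KappaMinkowski

/-! ### The function space, the star product and the momentum operators -/

/-- The (symmetrically normalised) Fourier transform on the plane,
`h ↦ (1/2π) ∫ h(u,v) exp(-i(αu+βv)) du dv`. -/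
def fourier (h : ℝ × ℝ → ℂ) (p : ℝ × ℝ) : ℂ :=
  1 / (2 * (Real.pi : ℂ)) *
    ∫ q : ℝ × ℝ, h q * Complex.exp (-Complex.I * ((p.1 * q.1 + p.2 * q.2 : ℝ) : ℂ))

/-- The inverse transform; `hat f` is the function of which `f` is the Fourier transform. -/
def hat (f : ℝ × ℝ → ℂ) (q : ℝ × ℝ) : ℂ :=
  1 / (2 * (Real.pi : ℂ)) *
    ∫ p : ℝ × ℝ, f p * Complex.exp (Complex.I * ((p.1 * q.1 + p.2 * q.2 : ℝ) : ℂ))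

theorem integrable_kernel {h : ℝ × ℝ → ℂ} (h1 : ContDiff ℝ ((⊤ : ℕ∞) : WithTop ℕ∞) h) (h2 : HasCompactSupport h)
    (p : ℝ × ℝ) :
    Integrable (fun q : ℝ × ℝ =>
      h q * Complex.exp (-Complex.I * ((p.1 * q.1 + p.2 * q.2 : ℝ) : ℂ))) := by
  have hc := h1.continuous
  exact Continuous.integrable_of_hasCompactSupport (by fun_prop) h2.mul_right

/-- The space `𝓑` of Fourier transforms of smooth compactly supported functions on the plane. -/
def B : Submodule ℂ (ℝ × ℝ → ℂ) where
  carrier := {f | ∃ h : ℝ × ℝ → ℂ, ContDiff ℝ ((⊤ : ℕ∞) : WithTop ℕ∞) h ∧ HasCompactSupport h ∧ f = fourier h}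
  zero_mem' := ⟨0, contDiff_const, HasCompactSupport.zero, by ext p; simp [fourier]⟩
  add_mem' := by
    rintro _ _ ⟨h, h1, h2, rfl⟩ ⟨k, k1, k2, rfl⟩
    refine ⟨h + k, h1.add k1, h2.add k2, ?_⟩
    ext p
    simp only [fourier, Pi.add_apply, add_mul]
    rw [integral_add (integrable_kernel h1 h2 p) (integrable_kernel k1 k2 p)]
    ring
  smul_mem' := by
    rintro c _ ⟨h, h1, h2, rfl⟩
    refine ⟨c • h, h1.const_smul c, h2.smul_left (f := fun _ => c), ?_⟩
    ext p
    simp only [fourier, Pi.smul_apply, smul_eq_mul, mul_assoc, integral_const_mul]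
    ring

/-- The κ-star product
`(f * g)(α,β) = (1/2π) ∫ dv ∫ du f(α+u,β) g(α, exp(-v/κ) β) exp(-iuv)`. -/
def starProd (κ : ℝ) (f g : ℝ × ℝ → ℂ) (p : ℝ × ℝ) : ℂ :=
  1 / (2 * (Real.pi : ℂ)) *
    ∫ v : ℝ, ∫ u : ℝ, f (p.1 + u, p.2) * g (p.1, Real.exp (-v / κ) * p.2) *
      Complex.exp (-Complex.I * ((u * v : ℝ) : ℂ))

/-- `T_γ`: multiplication of `hat f` by `exp(γu)`; formally `(T_γ f)(α,β) = f(α+iγ,β)`. -/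
def T (γ : ℝ) (f : ℝ × ℝ → ℂ) : ℝ × ℝ → ℂ :=
  fourier fun q => hat f q * (Real.exp (γ * q.1) : ℂ)

/-- The momentum `P = ∂/∂β`. -/
def P (f : ℝ × ℝ → ℂ) (p : ℝ × ℝ) : ℂ := deriv (fun b : ℝ => f (p.1, b)) p.2

/-- The group-like generator `𝓔`, acting as `T_{1/κ}`. -/
def E (κ : ℝ) : (ℝ × ℝ → ℂ) → (ℝ × ℝ → ℂ) := T (1 / κ)

/-- The inverse `𝓔⁻¹`, acting as `T_{-1/κ}`. -/
def Einv (κ : ℝ) : (ℝ × ℝ → ℂ) → (ℝ × ℝ → ℂ) := T (-(1 / κ))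

/-! ### The first order calculus

The generating one-forms are numbered `0 = dx`, `1 = ψ₊`, `2 = ψ₋`. -/

/-- The bimodule rules `f ψ_j = ∑ i, ψ_i (rho i j f)`:
* `f dx = dx f + ψ₋ (i/κ) P f`,
* `f ψ₊ = ψ₊ 𝓔⁻¹ f + dx (2i/κ) 𝓔⁻¹ P f - ψ₋ (1/κ²) 𝓔⁻¹ P² f`,
* `f ψ₋ = ψ₋ 𝓔 f`. -/
def rho (κ : ℝ) (i j : Fin 3) (f : ℝ × ℝ → ℂ) : ℝ × ℝ → ℂ :=
  match j, i with
  | 0, 0 => f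
  | 0, 1 => 0
  | 0, 2 => (Complex.I / κ) • P f
  | 1, 0 => (2 * Complex.I / κ) • Einv κ (P f)
  | 1, 1 => Einv κ f
  | 1, 2 => (-1 / (κ : ℂ) ^ 2) • Einv κ (P (P f))
  | 2, 0 => 0
  | 2, 1 => 0
  | 2, 2 => E κ f

/-- The components of the exterior derivative of a function, `df = ∑ i, ψ_i (D i f)`. -/
def D (κ : ℝ) (i : Fin 3) (f : ℝ × ℝ → ℂ) : ℝ × ℝ → ℂ :=
  match i with
  | 0 => Einv κ (P f)
  | 1 => (-Complex.I * κ / 2) • (Einv κ f - f)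
  | 2 => (1 / 2 : ℂ) • ((Complex.I / κ) • Einv κ (P (P f)) + (Complex.I * κ) • (E κ f - f))

/-! ### The differential algebra

The calculus of all orders is the free right module over the anticommuting generators.  A form
is written as `∑ I, ψ_I ω_I` with the coefficient functions on the right, where `ψ_I` is the
wedge product of the generators in `I` in increasing order. -/

/-- Families of coefficient functions, indexed by sets of generators. -/
abbrev Form : Type := Finset (Fin 3) → ℝ × ℝ → ℂ

/-- The forms of degree `k` with coefficients in `𝓑`. -/
def Omega (k : ℕ) : Submodule ℂ Form where
  carrier := {ω | ∀ I, ω I ∈ B ∧ (I.card ≠ k → ω I = 0)}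
  zero_mem' := fun _ => ⟨B.zero_mem, fun _ => rfl⟩
  add_mem' := fun {ω η} hω hη I =>
    ⟨B.add_mem (hω I).1 (hη I).1, fun h => by
      rw [Pi.add_apply, (hω I).2 h, (hη I).2 h, add_zero]⟩
  smul_mem' := fun c ω hω I =>
    ⟨B.smul_mem c (hω I).1, fun h => by rw [Pi.smul_apply, (hω I).2 h, smul_zero]⟩

/-- A function as a form of degree zero. -/
def ofFun (f : ℝ × ℝ → ℂ) : Form := Pi.single ∅ f

/-- `ψ_i ∧ ω`, the generators being anticommuting. -/
def genWedge (i : Fin 3) (ω : Form) : Form := fun I =>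
  if i ∈ I then (-1 : ℂ) ^ (I.filter (· < i)).card • ω (I.erase i) else 0

/-- `ψ_{i₁} ∧ (ψ_{i₂} ∧ ( ⋯ ∧ ω))` for a list `[i₁, i₂, …]` of generators. -/
def wordWedge (L : List (Fin 3)) (ω : Form) : Form := L.foldr genWedge ω

/-- The product `f ψ_{j₁} ∧ ψ_{j₂} ∧ ⋯`, rewritten with the coefficients on the right by
moving the function successively through the generators. -/
def funWord (κ : ℝ) : List (Fin 3) → (ℝ × ℝ → ℂ) → Form
  | [], f => ofFun f
  | j :: L, f => ∑ i, genWedge i (funWord κ L (rho κ i j f))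

/-- The product of forms, `(ψ_I f) ∧ (ψ_J g) = ψ_I ∧ (f ψ_J) * g`. -/
def wedge (κ : ℝ) (ω η : Form) : Form :=
  ∑ I, ∑ J, wordWedge (I.sort (· ≤ ·))
    (fun K => starProd κ (funWord κ (J.sort (· ≤ ·)) (ω I) K) (η J))

/-- `df` for a function `f`. -/
def dFun (κ : ℝ) (f : ℝ × ℝ → ℂ) : Form := ∑ i, genWedge i (ofFun (D κ i f))

/-- The exterior derivative; the generators are closed, so `d(ψ_I f) = (-1)^|I| ψ_I ∧ df`. -/
def dForm (κ : ℝ) (ω : Form) : Form :=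
  ∑ I, (-1 : ℂ) ^ I.card • wordWedge (I.sort (· ≤ ·)) (dFun κ (ω I))

/-- `T_γ` on forms; it is trivial on the generators. -/
def TForm (γ : ℝ) (ω : Form) : Form := fun I => T γ (ω I)

/-- `(dx ∧ ψ₊ ∧ ψ₋) f`. -/
def volForm (f : ℝ × ℝ → ℂ) : Form := wordWedge [0, 1, 2] (ofFun f)

/-- `∫ (dx ∧ ψ₊ ∧ ψ₋) f = ∫ f`, the Lebesgue integral over the plane. -/
def intForm (ω : Form) : ℂ := ∫ p : ℝ × ℝ, ω Finset.univ p

/-! ### Twisted cycles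

The notions are stated for the graded subspaces `Ω k` of an ambient vector space `W`, the
operations being given by maps on `W` that matter only on these subspaces. -/

/-- `(⨁ k, Ω k, mul, d)` is a graded differential (not necessarily unital) algebra. -/
structure IsDGAlgebra {W : Type*} [AddCommGroup W] [Module ℂ W] (Ω : ℕ → Submodule ℂ W)
    (mul : W → W → W) (d : W → W) : Prop where
  indep : iSupIndep Ω
  mul_mem : ∀ k l, ∀ a ∈ Ω k, ∀ b ∈ Ω l, mul a b ∈ Ω (k + l)
  mul_add : ∀ k l, ∀ a ∈ Ω k, ∀ b ∈ Ω l, ∀ c ∈ Ω l, mul a (b + c) = mul a b + mul a c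
  add_mul : ∀ k l, ∀ a ∈ Ω k, ∀ b ∈ Ω k, ∀ c ∈ Ω l, mul (a + b) c = mul a c + mul b c
  smul_mul : ∀ k l, ∀ z : ℂ, ∀ a ∈ Ω k, ∀ b ∈ Ω l, mul (z • a) b = z • mul a b
  mul_smul : ∀ k l, ∀ z : ℂ, ∀ a ∈ Ω k, ∀ b ∈ Ω l, mul a (z • b) = z • mul a b
  mul_assoc : ∀ k l m, ∀ a ∈ Ω k, ∀ b ∈ Ω l, ∀ c ∈ Ω m, mul (mul a b) c = mul a (mul b c)
  d_mem : ∀ k, ∀ a ∈ Ω k, d a ∈ Ω (k + 1)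
  d_add : ∀ k, ∀ a ∈ Ω k, ∀ b ∈ Ω k, d (a + b) = d a + d b
  d_smul : ∀ k, ∀ z : ℂ, ∀ a ∈ Ω k, d (z • a) = z • d a
  d_d : ∀ k, ∀ a ∈ Ω k, d (d a) = 0
  leibniz : ∀ k l, ∀ a ∈ Ω k, ∀ b ∈ Ω l,
    d (mul a b) = mul (d a) b + (-1 : ℂ) ^ k • mul a (d b)

/-- `σ` is an automorphism of degree zero of the graded differential algebra. -/
structure IsDGAutomorphism {W : Type*} [AddCommGroup W] [Module ℂ W] (Ω : ℕ → Submodule ℂ W)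
    (mul : W → W → W) (d σ : W → W) : Prop where
  bij : ∀ k, Set.BijOn σ (Ω k) (Ω k)
  map_add : ∀ k, ∀ a ∈ Ω k, ∀ b ∈ Ω k, σ (a + b) = σ a + σ b
  map_smul : ∀ k, ∀ z : ℂ, ∀ a ∈ Ω k, σ (z • a) = z • σ a
  map_mul : ∀ k l, ∀ a ∈ Ω k, ∀ b ∈ Ω l, σ (mul a b) = mul (σ a) (σ b)
  map_d : ∀ k, ∀ a ∈ Ω k, σ (d a) = d (σ a)

/-- `φ` is a closed graded trace on forms of degree `n`, twisted by `σ`. -/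
structure IsClosedGradedTwistedTrace {W : Type*} [AddCommGroup W] [Module ℂ W]
    (Ω : ℕ → Submodule ℂ W) (mul : W → W → W) (d σ : W → W) (n : ℕ) (φ : W → ℂ) : Prop where
  map_add : ∀ a ∈ Ω n, ∀ b ∈ Ω n, φ (a + b) = φ a + φ b
  map_smul : ∀ z : ℂ, ∀ a ∈ Ω n, φ (z • a) = z * φ a
  closed : ∀ k, k + 1 = n → ∀ a ∈ Ω k, φ (d a) = 0
  twisted_trace : ∀ k l, k + l = n → ∀ a ∈ Ω k, ∀ b ∈ Ω l,
    φ (mul a b) = (-1 : ℂ) ^ (k * l) * φ (mul (σ b) a)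

/-- A twisted cycle of dimension `n` over an algebra `A` (a subspace of `V`, with product `m`
and automorphism `τ`): a graded differential algebra with an automorphism `σ`, a closed graded
trace twisted by `σ`, and an algebra isomorphism `ι` of `A` onto `Ω 0` intertwining `τ` and `σ`. -/
structure IsTwistedCycleOver {V W : Type*} [AddCommGroup V] [Module ℂ V] [AddCommGroup W]
    [Module ℂ W] (A : Submodule ℂ V) (m : V → V → V) (τ : V → V) (ι : V → W)
    (Ω : ℕ → Submodule ℂ W) (mul : W → W → W) (d σ : W → W) (n : ℕ) (φ : W → ℂ) : Prop where
  dga : IsDGAlgebra Ω mul d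
  aut : IsDGAutomorphism Ω mul d σ
  trace : IsClosedGradedTwistedTrace Ω mul d σ n φ
  m_mem : ∀ f ∈ A, ∀ g ∈ A, m f g ∈ A
  ι_bij : Set.BijOn ι (A : Set V) (Ω 0 : Set W)
  ι_add : ∀ f ∈ A, ∀ g ∈ A, ι (f + g) = ι f + ι g
  ι_smul : ∀ z : ℂ, ∀ f ∈ A, ι (z • f) = z • ι f
  ι_mul : ∀ f ∈ A, ∀ g ∈ A, ι (m f g) = mul (ι f) (ι g)
  τ_mem : ∀ f ∈ A, τ f ∈ A
  ι_twist : ∀ f ∈ A, ι (τ f) = σ (ι f)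

end KappaMinkowski

end

/-! On the Fourier side the theorem is a statement about the affine group of the line. With the
group law `gmul`, the weight `exp(-q.1/κ)` makes Lebesgue measure into left Haar measure, and the
star product of two transforms is the transform of the group convolution `conv`
(`starProd_fourier`).

The operators `rho` and `D` act by multiplication with the symbols `rmat` and `dvec`. The matrix
`rmat` is a representation R of the group with determinant one (`rmat_gmul`, `rmat_det`), and `dvec`
is a 1-cocycle for it: w(qs) = w(q) + R(q) w(s) (`dvec_gmul`). A form is thus the transform of a
test function h with values in the exterior algebra Λ on three generators. The wedge product becomes
the convolution `wconv`, which integrates h(q) ∧ Λ(R(q)) k(q⁻¹p) against left Haar measure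
(`wedge_fourierForm`), and d becomes pointwise left multiplication by the vector w(p)
(`dForm_fourierForm`).

The axioms can now be read off. Associativity holds because Λ(R(q)) acts by algebra maps and R is
multiplicative (`wconv_assoc`). The Leibniz rule is the cocycle identity together with the sign for
moving a vector past a form (`vec_wconv`). The relation d² = 0 is w ∧ w = 0. The map T_γ multiplies
by the character exp(γ q.1), so it respects the convolution and commutes with pointwise operations.

The integral of a transform is 2π times the value at the group identity, where w vanishes; hence
closedness. The value of h * k at the identity pairs h(q) with k(q⁻¹). Exchanging the factors by q ↦
q⁻¹ produces the modular function exp(q.1/κ), which is the twist T_{1/κ}. In the exterior algebra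
the exchange is graded commutativity after applying Λ(R(q)), which is the identity in top degree
since det R = 1 (`wmul_twisted_comm`, `wconv_twisted_trace`). -/

noncomputable section

namespace KappaMinkowski

open scoped FourierTransform ContDiff Matrix

/-! ### Fourier inversion for smooth compactly supported functions -/

section Inversion

variable {V : Type*} [NormedAddCommGroup V] [InnerProductSpace ℝ V] [FiniteDimensional ℝ V]
  [MeasurableSpace V] [BorelSpace V]

/-- The Fourier transform of a test function, without normalising factors, as a Schwartz map. -/
theorem exists_schwartz_fourier {h : V → ℂ} (h1 : ContDiff ℝ ∞ h) (h2 : HasCompactSupport h) :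
    ∃ F : SchwartzMap V ℂ,
      (∀ x, F x = ∫ y, h y * Complex.exp (-Complex.I * ((inner ℝ x y : ℝ) : ℂ))) ∧
      ∀ y, ∫ x, F x * Complex.exp (Complex.I * ((inner ℝ x y : ℝ) : ℂ)) =
        (2 * Real.pi : ℂ) ^ Module.finrank ℝ V * h y := by
  have hpi : (2 * Real.pi) ≠ 0 := by positivity
  set s : SchwartzMap V ℂ := h2.toSchwartzMap h1
  have hs : (s : V → ℂ) = h := rfl
  -- The dilation by 1/(2π) converts the kernel exp(-2πi⟨x,y⟩) of `𝓕` into exp(-i⟨x,y⟩). Undoing it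
  -- in the inverse integral is what produces the factor (2π)^dim.
  set e : V ≃L[ℝ] V := ContinuousLinearEquiv.smulLeft (Units.mk0 (2 * Real.pi)⁻¹ (inv_ne_zero hpi))
  have he : ∀ x, e x = (2 * Real.pi)⁻¹ • x := fun x => rfl
  have key : ∀ x, 𝓕 h ((2 * Real.pi)⁻¹ • x) =
      ∫ y, h y * Complex.exp (-Complex.I * ((inner ℝ x y : ℝ) : ℂ)) := by
    intro x
    rw [Real.fourier_eq']
    refine integral_congr_ae (.of_forall fun y => ?_)
    simp only [smul_eq_mul]
    rw [mul_comm, inner_smul_right, real_inner_comm]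
    congr 2
    have : -2 * Real.pi * ((2 * Real.pi)⁻¹ * inner ℝ x y) = - inner ℝ x y := by
      field_simp
    rw [this]; push_cast; ring
  refine ⟨SchwartzMap.compCLMOfContinuousLinearEquiv ℂ e (𝓕 s), fun x => ?_, fun y => ?_⟩
  · rw [← key, SchwartzMap.compCLMOfContinuousLinearEquiv_apply, Function.comp_apply, he,
      SchwartzMap.fourier_coe, hs]
  · have inv : 𝓕⁻ (𝓕 h) y = h y := by
      rw [Continuous.fourierInv_fourier_eq h1.continuous (h1.continuous.integrable_of_hasCompactSupport h2)]
      rw [← hs, ← SchwartzMap.fourier_coe]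
      exact (𝓕 s).integrable
    rw [← inv, Real.fourierInv_eq']
    have := Measure.integral_comp_smul (volume : Measure V)
      (fun x => 𝓕 h ((2 * Real.pi)⁻¹ • x) * Complex.exp (Complex.I * ((inner ℝ x y : ℝ) : ℂ)))
      (2 * Real.pi)
    simp only [SchwartzMap.compCLMOfContinuousLinearEquiv_apply, Function.comp_apply, he,
      SchwartzMap.fourier_coe, hs]
    rw [abs_of_nonneg (by positivity), eq_inv_smul_iff₀ (by positivity)] at this
    rw [← this, Complex.real_smul]
    push_cast
    congr 1
    refine integral_congr_ae (.of_forall fun x => ?_)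
    simp only [smul_smul, inv_mul_cancel₀ hpi, one_smul, inner_smul_left, smul_eq_mul]
    rw [mul_comm]
    congr 2
    simp
    ring

end Inversion

/-- The Fourier transform on the plane of a test function is a Schwartz function, and the
transform is inverted by `hat`. -/
theorem fourier_schwartz {h : ℝ × ℝ → ℂ} (h1 : ContDiff ℝ ∞ h) (h2 : HasCompactSupport h) :
    (∃ F : SchwartzMap (ℝ × ℝ) ℂ, fourier h = F) ∧ hat (fourier h) = h := by
  -- The product ℝ × ℝ carries the sup norm, so the inner-product result is applied on `WithLp 2 (ℝ
  -- × ℝ)` and carried back along the measure-preserving identification. The dimension two gives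
  -- (2π)², which cancels the two normalising factors.
  set e := WithLp.prodContinuousLinearEquiv 2 ℝ ℝ ℝ
  have he : ∀ x, e x = x.ofLp := fun x => rfl
  have hes : ∀ x, e.symm x = WithLp.toLp 2 x := fun x => rfl
  have mp := WithLp.volume_preserving_ofLp ℝ ℝ
  have emb : MeasurableEmbedding (WithLp.ofLp : WithLp 2 (ℝ × ℝ) → ℝ × ℝ) :=
    (MeasurableEquiv.toLp 2 (ℝ × ℝ)).symm.measurableEmbedding
  have inner_eq : ∀ x y : WithLp 2 (ℝ × ℝ), inner ℝ x y = x.ofLp.1 * y.ofLp.1 + x.ofLp.2 * y.ofLp.2 := by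
    intro x y; rw [WithLp.prod_inner_apply]; simp [mul_comm]
  obtain ⟨F, hF1, hF2⟩ := exists_schwartz_fourier (V := WithLp 2 (ℝ × ℝ)) (h := h ∘ e)
    (h1.comp e.contDiff) (h2.comp_homeomorph e.toHomeomorph)
  have ff : ∀ p, fourier h p = 1 / (2 * (Real.pi : ℂ)) * F (WithLp.toLp 2 p) := by
    intro p
    rw [hF1, fourier, ← mp.integral_comp emb]
    simp only [inner_eq, Function.comp_apply, he]
  refine ⟨⟨(1 / (2 * (Real.pi : ℂ))) • SchwartzMap.compCLMOfContinuousLinearEquiv ℂ e.symm F, ?_⟩, ?_⟩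
  · ext p
    simp [ff, hes]
  · ext q
    have := hF2 (WithLp.toLp 2 q)
    rw [e.toLinearEquiv.finrank_eq, Module.finrank_prod, Module.finrank_self] at this
    rw [hat, ← mp.integral_comp emb]
    simp only [ff, inner_eq, Function.comp_apply, he, WithLp.toLp_ofLp] at this ⊢
    simp only [mul_assoc] at this ⊢
    rw [integral_const_mul, this]
    have : (Real.pi : ℂ) ≠ 0 := by simp [Real.pi_ne_zero]
    simp
    field_simp

theorem hat_fourier {h : ℝ × ℝ → ℂ} (h1 : ContDiff ℝ ∞ h) (h2 : HasCompactSupport h) :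
    hat (fourier h) = h := (fourier_schwartz h1 h2).2

theorem integrable_fourier {h : ℝ × ℝ → ℂ} (h1 : ContDiff ℝ ∞ h) (h2 : HasCompactSupport h) :
    Integrable (fourier h) := by
  obtain ⟨F, hF⟩ := (fourier_schwartz h1 h2).1
  rw [hF]
  exact F.integrable

/-- This is Fourier inversion at the origin. It turns the integral of forms into evaluation at the
identity of the affine group. -/
theorem integral_fourier {h : ℝ × ℝ → ℂ} (h1 : ContDiff ℝ ∞ h) (h2 : HasCompactSupport h) :
    ∫ p, fourier h p = 2 * Real.pi * h 0 := by
  have := congrFun (hat_fourier h1 h2) 0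
  simp only [hat, Prod.fst_zero, Prod.snd_zero, mul_zero, add_zero, Complex.ofReal_zero,
    Complex.exp_zero, mul_one] at this
  rw [← this]
  have : (Real.pi : ℂ) ≠ 0 := by simp [Real.pi_ne_zero]
  field_simp

/-- Inversion on the line. -/
theorem integral_integral_exp {h : ℝ → ℂ} (h1 : ContDiff ℝ ∞ h) (h2 : HasCompactSupport h) (y : ℝ) :
    ∫ x : ℝ, (∫ a : ℝ, h a * Complex.exp (-Complex.I * ((x * a : ℝ) : ℂ))) *
      Complex.exp (Complex.I * ((x * y : ℝ) : ℂ)) = 2 * Real.pi * h y := by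
  obtain ⟨F, hF1, hF2⟩ := exists_schwartz_fourier h1 h2
  have := hF2 y
  simp only [hF1, Module.finrank_self, pow_one] at this
  rw [← this]
  simp [mul_comm]

theorem contDiff_integral_param {P G : Type*} [NormedAddCommGroup P] [NormedSpace ℝ P]
    [NormedAddCommGroup G] [NormedSpace ℝ G] [MeasurableSpace G] [BorelSpace G]
    {μ : Measure G} [IsFiniteMeasureOnCompacts μ] [μ.IsNegInvariant] [IsLocallyFiniteMeasure μ]
    {g : P → G → ℂ} (hg : ContDiff ℝ ∞ (fun z : P × G => g z.1 z.2))
    {K : Set G} (hK : IsCompact K) (h0 : ∀ p, ∀ x ∉ K, g p x = 0) :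
    ContDiff ℝ ∞ (fun p => ∫ x, g p x ∂μ) := by
  -- The integral is the value at 0 of the convolution of the constant 1 with x ↦ g p (-x), whose
  -- support lies in -K for every p.
  have := contDiffOn_convolution_right_with_param_comp (𝕜 := ℝ) (μ := μ) (n := ⊤)
    (ContinuousLinearMap.mul ℝ ℂ) (s := Set.univ) (v := fun _ : P => (0 : G)) contDiffOn_const
    (f := fun _ => 1) (g := fun p x => g p (-x)) (k := -K) isOpen_univ hK.neg
    (fun p x _ hx => h0 p _ (by simpa using hx)) (locallyIntegrable_const 1)
    (by
      refine ContDiff.contDiffOn ?_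
      exact hg.comp (contDiff_fst.prodMk contDiff_snd.neg))
  rw [contDiffOn_univ] at this
  simpa [convolution] using this

/-! ### The group underlying the star product -/

/-- The product of the affine group of the line, in the coordinates dual to `(α, β)`. -/
def gmul (κ : ℝ) (q s : ℝ × ℝ) : ℝ × ℝ := (q.1 + s.1, q.2 + Real.exp (q.1 / κ) * s.2)

/-- The inverse in the affine group. -/
def ginv (κ : ℝ) (q : ℝ × ℝ) : ℝ × ℝ := (-q.1, -(Real.exp (-q.1 / κ) * q.2))

section Group

variable (κ : ℝ) (q r s : ℝ × ℝ)

theorem gmul_assoc : gmul κ (gmul κ q r) s = gmul κ q (gmul κ r s) := by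
  simp only [gmul, add_div, Real.exp_add, Prod.mk.injEq]
  constructor <;> ring

theorem ginv_gmul : gmul κ (ginv κ q) q = 0 := by
  simp [gmul, ginv]

theorem gmul_ginv : gmul κ q (ginv κ q) = 0 := by
  ext <;> simp [gmul, ginv, ← mul_assoc, ← Real.exp_add, neg_div]

@[simp] theorem zero_gmul : gmul κ 0 q = q := by simp [gmul]

@[simp] theorem gmul_zero : gmul κ q 0 = q := by simp [gmul]

@[simp] theorem ginv_gmul_cancel : gmul κ (ginv κ q) (gmul κ q s) = s := by
  rw [← gmul_assoc, ginv_gmul, zero_gmul]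

@[simp] theorem gmul_ginv_cancel : gmul κ q (gmul κ (ginv κ q) s) = s := by
  rw [← gmul_assoc, gmul_ginv, zero_gmul]

@[simp] theorem ginv_ginv : ginv κ (ginv κ q) = q := by
  have h := ginv_gmul_cancel κ (ginv κ q) q
  rwa [ginv_gmul, gmul_zero] at h

theorem ginv_gmul_rev : ginv κ (gmul κ q s) = gmul κ (ginv κ s) (ginv κ q) := by
  have h := ginv_gmul_cancel κ (gmul κ q s) (gmul κ (ginv κ s) (ginv κ q))
  rwa [gmul_assoc κ q s, gmul_ginv_cancel, gmul_ginv, gmul_zero] at h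

theorem continuous_gmul : Continuous fun z : (ℝ × ℝ) × (ℝ × ℝ) => gmul κ z.1 z.2 := by
  unfold gmul; fun_prop

theorem continuous_ginv : Continuous (ginv κ) := by
  unfold ginv; fun_prop

theorem contDiff_gmul : ContDiff ℝ ∞ fun z : (ℝ × ℝ) × (ℝ × ℝ) => gmul κ z.1 z.2 := by
  unfold gmul; fun_prop

theorem contDiff_ginv : ContDiff ℝ ∞ (ginv κ) := by
  unfold ginv; fun_prop

/-- Left translation as a homeomorphism. -/
def gmulLeft : (ℝ × ℝ) ≃ₜ (ℝ × ℝ) where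
  toFun := gmul κ q
  invFun := gmul κ (ginv κ q)
  left_inv s := by simp
  right_inv s := by simp
  continuous_toFun := (continuous_gmul κ).comp (Continuous.prodMk_right q)
  continuous_invFun := (continuous_gmul κ).comp (Continuous.prodMk_right (ginv κ q))

/-- Change of variables on the plane for a bijection with given Jacobian matrix. -/
theorem integral_comp_jacobian {E : Type*} [NormedAddCommGroup E] [NormedSpace ℝ E]
    {f : ℝ × ℝ → ℝ × ℝ} (hf : Function.Bijective f) {M : ℝ × ℝ → Matrix (Fin 2) (Fin 2) ℝ}
    (hM : ∀ x, HasFDerivAt f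
      (LinearMap.toContinuousLinearMap
        (Matrix.toLin (Module.Basis.finTwoProd ℝ) (Module.Basis.finTwoProd ℝ) (M x))) x)
    (g : ℝ × ℝ → E) : ∫ x, g x = ∫ x, |(M x).det| • g (f x) := by
  have := integral_image_eq_integral_abs_det_fderiv_smul volume MeasurableSet.univ
    (fun x _ => (hM x).hasFDerivWithinAt) hf.injective.injOn g
  rw [Set.image_univ, hf.surjective.range_eq] at this
  simpa using this

/-- Left translation by q has constant Jacobian exp(q.1/κ), so exp(-x.1/κ) dx is a left Haar
measure. This is the weight appearing in `conv` and `wconv`. -/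
theorem integral_gmul_left {E : Type*} [NormedAddCommGroup E] [NormedSpace ℝ E]
    (g : ℝ × ℝ → E) : ∫ x, g x = Real.exp (q.1 / κ) • ∫ x, g (gmul κ q x) := by
  rw [integral_comp_jacobian (gmulLeft κ q).bijective
    (M := fun _ => !![1, 0; 0, Real.exp (q.1 / κ)]) ?_ g, ← integral_smul]
  · simp only [Matrix.det_fin_two_of, one_mul, mul_zero, sub_zero, Real.abs_exp]
    rfl
  · intro x
    rw [Matrix.toLin_finTwoProd_toContinuousLinearMap]
    change HasFDerivAt (fun s : ℝ × ℝ => (q.1 + s.1, q.2 + Real.exp (q.1 / κ) * s.2)) _ x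
    have h1 : HasFDerivAt (Prod.fst : ℝ × ℝ → ℝ) (ContinuousLinearMap.fst ℝ ℝ ℝ) x := hasFDerivAt_fst
    have h2 : HasFDerivAt (Prod.snd : ℝ × ℝ → ℝ) (ContinuousLinearMap.snd ℝ ℝ ℝ) x := hasFDerivAt_snd
    convert! HasFDerivAt.prodMk (h1.const_add q.1)
      ((h2.const_mul (Real.exp (q.1 / κ))).const_add q.2) using 2 <;> simp

/-- The Jacobian of inversion is the source of the modular function, hence of the twist in the
trace. -/
theorem integral_ginv {E : Type*} [NormedAddCommGroup E] [NormedSpace ℝ E]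
    (g : ℝ × ℝ → E) : ∫ x, g x = ∫ x : ℝ × ℝ, Real.exp (-x.1 / κ) • g (ginv κ x) := by
  rw [integral_comp_jacobian (Function.Involutive.bijective (ginv_ginv κ))
    (M := fun x => !![-1, 0; Real.exp (-x.1 / κ) / κ * x.2, -Real.exp (-x.1 / κ)]) ?_ g]
  · simp [Matrix.det_fin_two_of]
  · intro x
    rw [Matrix.toLin_finTwoProd_toContinuousLinearMap]
    change HasFDerivAt (fun q : ℝ × ℝ => (-q.1, -(Real.exp (-q.1 / κ) * q.2))) _ x
    have h1 : HasFDerivAt (Prod.fst : ℝ × ℝ → ℝ) (ContinuousLinearMap.fst ℝ ℝ ℝ) x := hasFDerivAt_fst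
    have h2 : HasFDerivAt (Prod.snd : ℝ × ℝ → ℝ) (ContinuousLinearMap.snd ℝ ℝ ℝ) x := hasFDerivAt_snd
    have h3 := HasFDerivAt.prodMk h1.neg ((((h1.neg.mul_const κ⁻¹).exp).mul h2).neg)
    simp only [← div_eq_mul_inv] at h3
    convert! h3 using 2
    · ext <;> simp
    · ext <;> simp
      ring

end Group

/-! ### The operators on Fourier transforms -/

theorem B_mem {h : ℝ × ℝ → ℂ} (h1 : ContDiff ℝ ∞ h) (h2 : HasCompactSupport h) :
    fourier h ∈ B := ⟨h, h1, h2, rfl⟩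

theorem T_fourier {h : ℝ × ℝ → ℂ} (h1 : ContDiff ℝ ∞ h) (h2 : HasCompactSupport h) (γ : ℝ) :
    T γ (fourier h) = fourier fun q => Complex.exp (γ * q.1) * h q := by
  rw [T, hat_fourier h1 h2]
  congr 1
  ext q
  push_cast
  ring

theorem P_fourier {h : ℝ × ℝ → ℂ} (h1 : ContDiff ℝ ∞ h) (h2 : HasCompactSupport h) :
    P (fourier h) = fourier fun q => (-Complex.I * q.2) * h q := by
  ext p
  have hc := h1.continuous
  have := hasDerivAt_integral_of_dominated_loc_of_deriv_le (μ := (volume : Measure (ℝ × ℝ)))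
    (F := fun (b : ℝ) (q : ℝ × ℝ) =>
      h q * Complex.exp (-Complex.I * ((p.1 * q.1 + b * q.2 : ℝ) : ℂ)))
    (F' := fun (b : ℝ) (q : ℝ × ℝ) =>
      (-Complex.I * q.2) * h q * Complex.exp (-Complex.I * ((p.1 * q.1 + b * q.2 : ℝ) : ℂ)))
    -- The exponential has modulus one for every real b, so a single integrable bound serves for all
    -- b.
    (x₀ := p.2) (s := Set.univ) (bound := fun q => ‖(-Complex.I * q.2) * h q‖) Filter.univ_mem
    (.of_forall fun b => Continuous.aestronglyMeasurable (by fun_prop))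
    (integrable_kernel h1 h2 p) (Continuous.aestronglyMeasurable (by fun_prop))
    (.of_forall fun q b _ => by
      rw [norm_mul _ (Complex.exp _), Complex.norm_exp]
      simp)
    (Continuous.integrable_of_hasCompactSupport (by fun_prop) h2.mul_left.norm)
    (.of_forall fun q b _ => by
      have h1 : HasDerivAt (fun b : ℝ => ((p.1 * q.1 + b * q.2 : ℝ) : ℂ)) q.2 b := by
        have : HasDerivAt (fun b : ℝ => p.1 * q.1 + b * q.2) q.2 b := by
          simpa using ((hasDerivAt_id b).mul_const q.2).const_add (p.1 * q.1)
        exact this.ofReal_comp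
      convert! ((h1.const_mul (-Complex.I)).cexp.const_mul (h q)) using 1
      ring)
  exact (this.2.const_mul (1 / (2 * (Real.pi : ℂ)))).deriv

theorem fourier_add {h k : ℝ × ℝ → ℂ} (h1 : ContDiff ℝ ∞ h) (h2 : HasCompactSupport h)
    (k1 : ContDiff ℝ ∞ k) (k2 : HasCompactSupport k) :
    fourier (fun q => h q + k q) = fourier h + fourier k := by
  ext p
  simp only [fourier, Pi.add_apply, add_mul]
  rw [integral_add (integrable_kernel h1 h2 p) (integrable_kernel k1 k2 p)]
  ring

theorem fourier_smul (c : ℂ) (h : ℝ × ℝ → ℂ) :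
    fourier (fun q => c * h q) = c • fourier h := by
  ext p
  simp only [fourier, Pi.smul_apply, smul_eq_mul, mul_assoc, integral_const_mul]
  ring

@[simp] theorem fourier_zero : fourier (fun _ => 0) = 0 := by
  ext p; simp [fourier]

theorem fourier_sum {ι : Type*} (s : Finset ι) {h : ι → ℝ × ℝ → ℂ}
    (h1 : ∀ i, ContDiff ℝ ∞ (h i)) (h2 : ∀ i, HasCompactSupport (h i)) :
    fourier (fun q => ∑ i ∈ s, h i q) = ∑ i ∈ s, fourier (h i) := by
  ext p
  simp only [fourier, Finset.sum_apply, Finset.sum_mul]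
  rw [integral_finsetSum _ fun i _ => integrable_kernel (h1 i) (h2 i) p, Finset.mul_sum]

/-! ### Twisted convolution -/

/-- The convolution of the affine group, which the Fourier transform takes to the star product. -/
def conv (κ : ℝ) (h k : ℝ × ℝ → ℂ) (p : ℝ × ℝ) : ℂ :=
  1 / (2 * (Real.pi : ℂ)) *
    ∫ q : ℝ × ℝ, Real.exp (-q.1 / κ) * (h q * k (gmul κ (ginv κ q) p))

theorem contDiff_conv (κ : ℝ) {h k : ℝ × ℝ → ℂ} (h1 : ContDiff ℝ ∞ h) (h2 : HasCompactSupport h)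
    (k1 : ContDiff ℝ ∞ k) : ContDiff ℝ ∞ (conv κ h k) := by
  refine contDiff_const.mul (contDiff_integral_param ?_ h2 fun p q hq => ?_)
  · have e : ContDiff ℝ ∞ fun z : (ℝ × ℝ) × (ℝ × ℝ) => gmul κ (ginv κ z.2) z.1 :=
      (contDiff_gmul κ).comp (((contDiff_ginv κ).comp contDiff_snd).prodMk contDiff_fst)
    have e1 : ContDiff ℝ ∞ fun z : (ℝ × ℝ) × (ℝ × ℝ) => Real.exp (-z.2.1 / κ) := by fun_prop
    have e2 : ContDiff ℝ ∞ fun z : (ℝ × ℝ) × (ℝ × ℝ) => ((Real.exp (-z.2.1 / κ) : ℝ) : ℂ) :=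
      Complex.ofRealCLM.contDiff.comp e1
    exact e2.mul ((h1.comp contDiff_snd).mul (k1.comp e))
  · simp [image_eq_zero_of_notMem_tsupport hq]

theorem hasCompactSupport_conv (κ : ℝ) {h k : ℝ × ℝ → ℂ} (h2 : HasCompactSupport h)
    (k2 : HasCompactSupport k) : HasCompactSupport (conv κ h k) := by
  -- A nonzero integrand has q in the support of h and q⁻¹p in that of k, so p lies in the product
  -- of the two supports.
  refine HasCompactSupport.intro
    ((h2.isCompact.prod k2.isCompact).image (continuous_gmul κ)) fun p hp => ?_
  rw [conv, integral_eq_zero_of_ae, mul_zero]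
  refine .of_forall fun q => ?_
  by_cases hq : q ∈ tsupport h
  · have : gmul κ (ginv κ q) p ∉ tsupport k := fun hk =>
      hp ⟨(q, gmul κ (ginv κ q) p), ⟨hq, hk⟩, by simp⟩
    simp [image_eq_zero_of_notMem_tsupport this]
  · simp [image_eq_zero_of_notMem_tsupport hq]

/-! ### The star product of Fourier transforms -/

/-- The kernel of the Fourier transform. -/
def chi (p q : ℝ × ℝ) : ℂ := Complex.exp (-Complex.I * ((p.1 * q.1 + p.2 * q.2 : ℝ) : ℂ))

theorem continuous_chi (p : ℝ × ℝ) : Continuous (chi p) := by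
  unfold chi; fun_prop

/-- Plane waves multiply under the star product according to the group law: the second wave is seen
at the dilated point exp(q.1/κ) β, which is the dilation in `starProd` at v = -q.1. -/
theorem chi_gmul (κ : ℝ) (p q s : ℝ × ℝ) :
    chi p (gmul κ q s) = chi p q * chi (p.1, Real.exp (q.1 / κ) * p.2) s := by
  simp only [chi, gmul, ← Complex.exp_add]
  congr 1
  push_cast
  ring

theorem fourier_eq_chi (h : ℝ × ℝ → ℂ) (p : ℝ × ℝ) :
    fourier h p = 1 / (2 * (Real.pi : ℂ)) * ∫ q, h q * chi p q := rfl

theorem continuous_fourier {h : ℝ × ℝ → ℂ} (h1 : ContDiff ℝ ∞ h) (h2 : HasCompactSupport h) :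
    Continuous (fourier h) := by
  obtain ⟨F, hF⟩ := (fourier_schwartz h1 h2).1
  rw [hF]
  exact F.continuous

/-- The partial Fourier transform in the second variable. -/
def partialFourier (h : ℝ × ℝ → ℂ) (β a : ℝ) : ℂ :=
  ∫ b : ℝ, h (a, b) * Complex.exp (-Complex.I * ((β * b : ℝ) : ℂ))

section Partial

variable {h : ℝ × ℝ → ℂ} (h1 : ContDiff ℝ ∞ h) (h2 : HasCompactSupport h) (β : ℝ)
include h1 h2

theorem contDiff_partialFourier : ContDiff ℝ ∞ (partialFourier h β) := by
  refine contDiff_integral_param (K := Prod.snd '' tsupport h) ?_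
    (h2.isCompact.image continuous_snd) fun a b hb => ?_
  · have e : ContDiff ℝ ∞ fun z : ℝ × ℝ => ((β * z.2 : ℝ) : ℂ) :=
      Complex.ofRealCLM.contDiff.comp (contDiff_const.mul contDiff_snd)
    exact (h1.comp (contDiff_fst.prodMk contDiff_snd)).mul (contDiff_const.mul e).cexp
  · have : (a, b) ∉ tsupport h := fun hm => hb ⟨_, hm, rfl⟩
    simp [image_eq_zero_of_notMem_tsupport this]

omit h1 in
theorem hasCompactSupport_partialFourier : HasCompactSupport (partialFourier h β) := by
  refine HasCompactSupport.intro (h2.isCompact.image continuous_fst) fun a ha => ?_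
  refine integral_eq_zero_of_ae (.of_forall fun b => ?_)
  have : (a, b) ∉ tsupport h := fun hm => ha ⟨_, hm, rfl⟩
  simp [image_eq_zero_of_notMem_tsupport this]

/-- Since G depends on the first coordinate only, Fubini lets the second variable be integrated out
first. With G = 1 this factors the plane transform into two one-dimensional ones. -/
theorem integral_mul_fst (G : ℝ → ℂ) (hG : Continuous G) (x : ℝ) :
    ∫ q, h q * chi (x, β) q * G q.1 =
      ∫ a, partialFourier h β a * Complex.exp (-Complex.I * ((x * a : ℝ) : ℂ)) * G a := by
  have hc := h1.continuous
  have hchi := continuous_chi (x, β)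
  have hi : Integrable (fun q => h q * chi (x, β) q * G q.1) :=
    Continuous.integrable_of_hasCompactSupport (by fun_prop) (h2.mul_right.mul_right)
  rw [Measure.volume_eq_prod] at hi ⊢
  rw [integral_prod _ hi]
  refine integral_congr_ae (.of_forall fun a => ?_)
  simp only [partialFourier]
  rw [← integral_mul_const, ← integral_mul_const]
  refine integral_congr_ae (.of_forall fun b => ?_)
  simp only [chi, Complex.ofReal_add, mul_add, Complex.exp_add]
  ring

/-- This is the inner integral of the star product. As a function of its first argument the
transform is itself a transform on the line, so integrating against exp(-iuv) inverts it at -v; the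
shift by x only contributes a phase. -/
theorem integral_fourier_line (x v : ℝ) :
    ∫ u : ℝ, fourier h (x + u, β) * Complex.exp (-Complex.I * ((u * v : ℝ) : ℂ)) =
      Complex.exp (Complex.I * ((x * v : ℝ) : ℂ)) * partialFourier h β (-v) := by
  have inv := integral_integral_exp (contDiff_partialFourier h1 h2 β)
    (hasCompactSupport_partialFourier h2 β) (-v)
  have fl : ∀ y : ℝ, fourier h (y, β) = 1 / (2 * (Real.pi : ℂ)) *
      ∫ a : ℝ, partialFourier h β a * Complex.exp (-Complex.I * ((y * a : ℝ) : ℂ)) := by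
    intro y
    have := integral_mul_fst h1 h2 β (fun _ => 1) continuous_const y
    simp only [mul_one] at this
    rw [fourier_eq_chi, this]
  have tr := integral_add_left_eq_self (μ := volume) (fun u : ℝ => fourier h (u, β) *
    Complex.exp (-Complex.I * (((u - x) * v : ℝ) : ℂ))) x
  simp only [add_sub_cancel_left] at tr
  rw [tr]
  have hpi : (Real.pi : ℂ) ≠ 0 := by simp [Real.pi_ne_zero]
  have e : partialFourier h β (-v) = 1 / (2 * (Real.pi : ℂ)) * (2 * Real.pi * partialFourier h β (-v)) := by
    field_simp
  rw [e, ← inv, ← integral_const_mul, ← integral_const_mul]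
  refine integral_congr_ae (.of_forall fun u => ?_)
  simp only [fl]
  have : Complex.exp (-Complex.I * (((u - x) * v : ℝ) : ℂ)) =
      Complex.exp (Complex.I * ((x * v : ℝ) : ℂ)) * Complex.exp (Complex.I * ((u * -v : ℝ) : ℂ)) := by
    rw [← Complex.exp_add]
    congr 1
    push_cast
    ring
  rw [this]
  ring

end Partial

theorem starProd_fourier (κ : ℝ) {h k : ℝ × ℝ → ℂ} (h1 : ContDiff ℝ ∞ h) (h2 : HasCompactSupport h)
    (k1 : ContDiff ℝ ∞ k) (k2 : HasCompactSupport k) :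
    starProd κ (fourier h) (fourier k) = fourier (conv κ h k) := by
  ext p
  have hc := h1.continuous
  have kc := k1.continuous
  have hchi := continuous_chi p
  have hk := continuous_fourier k1 k2
  have hm := continuous_gmul κ
  have hi := continuous_ginv κ
  set c : ℂ := 1 / (2 * (Real.pi : ℂ)) with hcdef
  -- The u-integral is Fourier inversion on the line, and v = -a identifies the remaining variable
  -- with the first coordinate of q.
  have s1 : starProd κ (fourier h) (fourier k) p =
      c * ∫ q, h q * chi p q * fourier k (p.1, Real.exp (q.1 / κ) * p.2) := by
    rw [integral_mul_fst h1 h2 p.2 (fun a => fourier k (p.1, Real.exp (a / κ) * p.2)) (by fun_prop) p.1,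
      ← integral_neg_eq_self, starProd]
    congr 1
    refine integral_congr_ae (.of_forall fun v => ?_)
    simp only
    calc _ = ∫ u : ℝ, fourier h (p.1 + u, p.2) * Complex.exp (-Complex.I * ((u * v : ℝ) : ℂ)) *
          fourier k (p.1, Real.exp (-v / κ) * p.2) := by
          refine integral_congr_ae (.of_forall fun u => ?_)
          simp only
          ring
      _ = _ := by
          rw [integral_mul_const, integral_fourier_line h1 h2]
          rw [mul_comm (Complex.exp _)]
          congr 3
          push_cast
          ring
  -- Substituting r = qs in the transform of k: the Jacobian of left translation cancels against the
  -- Haar weight.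
  have s2 : ∀ q, h q * chi p q * fourier k (p.1, Real.exp (q.1 / κ) * p.2) =
      c * ∫ r, Real.exp (-q.1 / κ) * (h q * k (gmul κ (ginv κ q) r)) * chi p r := by
    intro q
    rw [integral_gmul_left κ q, fourier_eq_chi, ← integral_const_mul, ← integral_const_mul,
      Complex.real_smul, ← integral_const_mul, ← integral_const_mul]
    refine integral_congr_ae (.of_forall fun s => ?_)
    simp only [ginv_gmul_cancel, chi_gmul]
    have : ((Real.exp (q.1 / κ) : ℝ) : ℂ) * ((Real.exp (-q.1 / κ) : ℝ) : ℂ) = 1 := by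
      rw [← Complex.ofReal_mul, ← Real.exp_add]
      simp [neg_div]
    linear_combination (-(h q * k s * chi p q * chi (p.1, Real.exp (q.1 / κ) * p.2) s) * c) * this
  rw [s1, fourier_eq_chi]
  simp only [s2]
  rw [integral_const_mul, integral_integral_swap_of_hasCompactSupport]
  · congr 1
    rw [← integral_const_mul]
    refine integral_congr_ae (.of_forall fun r => ?_)
    simp only [conv]
    rw [integral_mul_const, mul_assoc]
  · unfold Function.uncurry
    have e : Continuous fun z : (ℝ × ℝ) × (ℝ × ℝ) => gmul κ (ginv κ z.1) z.2 :=
      hm.comp ((hi.comp continuous_fst).prodMk continuous_snd)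
    have e1 : Continuous fun z : (ℝ × ℝ) × (ℝ × ℝ) => Real.exp (-z.1.1 / κ) := by fun_prop
    exact ((Complex.continuous_ofReal.comp e1).mul ((hc.comp continuous_fst).mul (kc.comp e))).mul
      (hchi.comp continuous_snd)
  · refine HasCompactSupport.intro ((h2.isCompact.prod k2.isCompact).image
      (f := fun z : (ℝ × ℝ) × (ℝ × ℝ) => (z.1, gmul κ z.1 z.2)) (by fun_prop)) fun z hz => ?_
    simp only [Function.uncurry]
    by_cases hq : z.1 ∈ tsupport h
    · have : gmul κ (ginv κ z.1) z.2 ∉ tsupport k := fun hk =>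
        hz ⟨(z.1, gmul κ (ginv κ z.1) z.2), ⟨hq, hk⟩, by simp⟩
      simp [image_eq_zero_of_notMem_tsupport this]
    · simp [image_eq_zero_of_notMem_tsupport hq]

/-! ### The exterior algebra on three generators -/

/-- The exterior algebra on three generators, in the basis of increasing wedge monomials. -/
abbrev Lam : Type := Finset (Fin 3) → ℂ

/-- Left multiplication by a generator. -/
def gen (i : Fin 3) : Module.End ℂ Lam where
  toFun x I := if i ∈ I then (-1 : ℂ) ^ (I.filter (· < i)).card * x (I.erase i) else 0
  map_add' x y := by ext I; by_cases h : i ∈ I <;> simp [h, mul_add]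
  map_smul' c x := by ext I; by_cases h : i ∈ I <;> simp [h, mul_left_comm]

theorem gen_apply (i : Fin 3) (x : Lam) (I : Finset (Fin 3)) :
    gen i x I = if i ∈ I then (-1 : ℂ) ^ (I.filter (· < i)).card * x (I.erase i) else 0 := rfl

/-- The unit of the exterior algebra. -/
def lamOne : Lam := Pi.single ∅ 1

theorem sum_finset_fin_three {M : Type*} [AddCommMonoid M] (f : Finset (Fin 3) → M) :
    ∑ I, f I = f ∅ + f {0} + f {1} + f {2} + f {0, 1} + f {0, 2} + f {1, 2} + f {0, 1, 2} := by
  have : (Finset.univ : Finset (Finset (Fin 3))) =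
      {∅, {0}, {1}, {2}, {0, 1}, {0, 2}, {1, 2}, {0, 1, 2}} := by decide
  rw [this, Finset.sum_insert (by decide), Finset.sum_insert (by decide),
    Finset.sum_insert (by decide), Finset.sum_insert (by decide), Finset.sum_insert (by decide),
    Finset.sum_insert (by decide), Finset.sum_insert (by decide), Finset.sum_singleton]
  simp only [add_assoc]

/-- The ordered product of the family `c` over `I`. -/
def wordProd {A : Type*} [Ring A] (c : Fin 3 → A) (I : Finset (Fin 3)) : A :=
  ((I.sort (· ≤ ·)).map c).prod

section Word

variable {A : Type*} [Ring A] [Algebra ℂ A] (c : Fin 3 → A)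

/-- The algebra map given by an anticommuting family, on the monomial basis. -/
def extMap : Lam →ₗ[ℂ] A where
  toFun x := ∑ I, x I • wordProd c I
  map_add' x y := by simp [add_smul, Finset.sum_add_distrib]
  map_smul' z x := by simp [Finset.smul_sum, smul_smul]

theorem extMap_apply (x : Lam) : extMap c x = ∑ I, x I • wordProd c I := rfl

theorem sort_pair_aux : (({0, 1} : Finset (Fin 3)).sort (· ≤ ·) = [0, 1]) ∧
    (({0, 2} : Finset (Fin 3)).sort (· ≤ ·) = [0, 2]) ∧
    (({1, 2} : Finset (Fin 3)).sort (· ≤ ·) = [1, 2]) ∧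
    (({0, 1, 2} : Finset (Fin 3)).sort (· ≤ ·) = [0, 1, 2]) := by
  refine ⟨?_, ?_, ?_, ?_⟩ <;> simp [Finset.sort_insert]

theorem extMap_eq (x : Lam) : extMap c x = x ∅ • 1 + x {0} • c 0 + x {1} • c 1 + x {2} • c 2 +
    x {0, 1} • (c 0 * c 1) + x {0, 2} • (c 0 * c 2) + x {1, 2} • (c 1 * c 2) +
    x {0, 1, 2} • (c 0 * c 1 * c 2) := by
  obtain ⟨h1, h2, h3, h4⟩ := sort_pair_aux
  simp [extMap_apply, sum_finset_fin_three, wordProd, h1, h2, h3, h4, mul_assoc]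

variable {c}

theorem extMap_lamOne : extMap c lamOne = 1 := by
  simp [extMap_eq, lamOne]

/-- An anticommuting family satisfies the relations of the generators. -/
theorem extMap_gen (hc : ∀ i j, c i * c j = -(c j * c i)) (i : Fin 3) (x : Lam) :
    extMap c (gen i x) = c i * extMap c x := by
  have sq : ∀ i, c i * c i = 0 := fun i => by
    have := hc i i
    have h2 : (2 : ℂ) • (c i * c i) = 0 := by rw [two_smul]; nth_rewrite 1 [this]; simp
    simpa using h2
  have sq' : ∀ i (a : A), c i * (c i * a) = 0 := fun i a => by rw [← mul_assoc, sq, zero_mul]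
  have h10 := hc 1 0
  have h20 := hc 2 0
  have h21 := hc 2 1
  have h10' : ∀ a, c 1 * (c 0 * a) = -(c 0 * (c 1 * a)) := fun a => by
    rw [← mul_assoc, h10, neg_mul, mul_assoc]
  have h20' : ∀ a, c 2 * (c 0 * a) = -(c 0 * (c 2 * a)) := fun a => by
    rw [← mul_assoc, h20, neg_mul, mul_assoc]
  have h21' : ∀ a, c 2 * (c 1 * a) = -(c 1 * (c 2 * a)) := fun a => by
    rw [← mul_assoc, h21, neg_mul, mul_assoc]
  have e1 : ({0, 1} : Finset (Fin 3)).erase 0 = {1} := by decide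
  have e2 : ({0, 1} : Finset (Fin 3)).erase 1 = {0} := by decide
  have e3 : ({0, 2} : Finset (Fin 3)).erase 0 = {2} := by decide
  have e4 : ({0, 2} : Finset (Fin 3)).erase 2 = {0} := by decide
  have e5 : ({1, 2} : Finset (Fin 3)).erase 1 = {2} := by decide
  have e6 : ({1, 2} : Finset (Fin 3)).erase 2 = {1} := by decide
  have e7 : ({0, 1, 2} : Finset (Fin 3)).erase 0 = {1, 2} := by decide
  have e8 : ({0, 1, 2} : Finset (Fin 3)).erase 1 = {0, 2} := by decide
  have e9 : ({0, 1, 2} : Finset (Fin 3)).erase 2 = {0, 1} := by decide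
  have n1 : (({0} : Finset (Fin 3)).filter (· < 0)).card = 0 := by decide
  have n2 : (({1} : Finset (Fin 3)).filter (· < 1)).card = 0 := by decide
  have n3 : (({2} : Finset (Fin 3)).filter (· < 2)).card = 0 := by decide
  have n4 : (({0, 1} : Finset (Fin 3)).filter (· < 0)).card = 0 := by decide
  have n5 : (({0, 1} : Finset (Fin 3)).filter (· < 1)).card = 1 := by decide
  have n6 : (({0, 2} : Finset (Fin 3)).filter (· < 0)).card = 0 := by decide
  have n7 : (({0, 2} : Finset (Fin 3)).filter (· < 2)).card = 1 := by decide
  have n8 : (({1, 2} : Finset (Fin 3)).filter (· < 1)).card = 0 := by decide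
  have n9 : (({1, 2} : Finset (Fin 3)).filter (· < 2)).card = 1 := by decide
  have n10 : (({0, 1, 2} : Finset (Fin 3)).filter (· < 0)).card = 0 := by decide
  have n11 : (({0, 1, 2} : Finset (Fin 3)).filter (· < 1)).card = 1 := by decide
  have n12 : (({0, 1, 2} : Finset (Fin 3)).filter (· < 2)).card = 2 := by decide
  rw [extMap_eq, extMap_eq]
  simp only [mul_add, mul_smul_comm, mul_one, mul_assoc]
  obtain rfl | rfl | rfl : i = 0 ∨ i = 1 ∨ i = 2 := by fin_cases i <;> simp
  · simp only [gen_apply, e1, e3, e7, n1, n4, n6, n10]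
    simp [sq, sq']
  · simp only [gen_apply, e2, e5, e8, n2, n5, n8, n11]
    simp [sq, sq', h10, h10']
  · simp only [gen_apply, e4, e6, e9, n3, n7, n9, n12]
    simp [sq, h20, h21, h20', h21']

end Word

theorem gen_anticomm (i j : Fin 3) : gen i * gen j = -(gen j * gen i) := by
  -- The sign rule is a finite check over the integers, where it is decidable; it is cast to ℂ
  -- afterwards.
  have sign : ∀ (I : Finset (Fin 3)) (i j : Fin 3), i ≠ j → i ∈ I → j ∈ I →
      (-1 : ℤ) ^ (I.filter (· < i)).card * (-1) ^ ((I.erase i).filter (· < j)).card =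
        -((-1) ^ (I.filter (· < j)).card * (-1) ^ ((I.erase j).filter (· < i)).card) := by
    decide
  refine LinearMap.ext fun x => funext fun I => ?_
  simp only [Module.End.mul_apply, LinearMap.neg_apply, Pi.neg_apply, gen_apply, Finset.mem_erase]
  by_cases hij : i = j
  · subst hij; simp
  by_cases hi : i ∈ I <;> by_cases hj : j ∈ I <;> simp only [hi, hj, hij, Ne.symm hij, ne_eq,
    not_false_eq_true, and_true, and_false, if_true, if_false, mul_zero, neg_zero]
  have := congrArg (Int.cast : ℤ → ℂ) (sign I i j hij hi hj)
  push_cast at this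
  rw [← mul_assoc, ← mul_assoc, this, Finset.erase_right_comm]
  ring

/-- The operator of left multiplication by an element of the exterior algebra. -/
def lmul : Lam →ₗ[ℂ] Module.End ℂ Lam := extMap gen

/-- Left multiplication by the vector `∑ i, w i ψ_i`. -/
def vec (w : Fin 3 → ℂ) : Module.End ℂ Lam := ∑ i, w i • gen i

theorem vec_anticomm (v w : Fin 3 → ℂ) : vec v * vec w = -(vec w * vec v) := by
  simp only [vec, Finset.sum_mul, Finset.mul_sum, ← Finset.sum_neg_distrib]
  rw [Finset.sum_comm]
  refine Finset.sum_congr rfl fun i _ => Finset.sum_congr rfl fun j _ => ?_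
  rw [smul_mul_smul_comm, smul_mul_smul_comm, gen_anticomm, smul_neg, mul_comm (v _)]

theorem lmul_vec (w : Fin 3 → ℂ) (x : Lam) : lmul (vec w x) = vec w * lmul x := by
  simp only [vec, LinearMap.sum_apply, LinearMap.smul_apply, map_sum, map_smul, Finset.sum_mul,
    lmul, extMap_gen gen_anticomm, smul_mul_assoc]

theorem gen_single {i : Fin 3} {J : Finset (Fin 3)} (h : ∀ k ∈ J, i < k) (a : ℂ) :
    gen i (Pi.single J a) = Pi.single (insert i J) a := by
  have hi : i ∉ J := fun hi => lt_irrefl _ (h i hi)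
  ext K
  rw [gen_apply]
  by_cases hK : K = insert i J
  · subst hK
    have : (insert i J).filter (· < i) = ∅ := by
      refine Finset.filter_eq_empty_iff.2 fun k hk => ?_
      rcases Finset.mem_insert.1 hk with rfl | hk
      · exact lt_irrefl _
      · exact (h k hk).not_gt
    simp [this, Finset.erase_insert hi]
  · rw [Pi.single_eq_of_ne hK]
    split_ifs with hiK
    · rw [Pi.single_eq_of_ne, mul_zero]
      rintro rfl
      exact hK (Finset.insert_erase hiK).symm
    · rfl

theorem prod_gen_lamOne {L : List (Fin 3)} (hL : L.Pairwise (· < ·)) :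
    (L.map gen).prod lamOne = Pi.single L.toFinset 1 := by
  induction L with
  | nil => rfl
  | cons j L ih =>
    rw [List.pairwise_cons] at hL
    rw [List.map_cons, List.prod_cons, Module.End.mul_apply, ih hL.2,
      gen_single (fun k hk => hL.1 k (List.mem_toFinset.1 hk)), List.toFinset_cons]

theorem wordProd_gen_lamOne (I : Finset (Fin 3)) : wordProd gen I lamOne = Pi.single I 1 := by
  rw [wordProd, prod_gen_lamOne (Finset.sortedLT_sort I).pairwise, Finset.sort_toFinset]

/-- Increasing words applied to the unit give the basis without signs. So an element is recovered
from its left multiplication operator, and products in Λ can be handled as products of operators. -/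
theorem lmul_lamOne (x : Lam) : lmul x lamOne = x := by
  simp only [lmul, extMap_apply, LinearMap.sum_apply, LinearMap.smul_apply, wordProd_gen_lamOne]
  ext K
  simp [Finset.sum_apply, Pi.single_apply]

theorem lam_induction {p : Lam → Prop} (one : p lamOne) (add : ∀ x y, p x → p y → p (x + y))
    (smul : ∀ (c : ℂ) x, p x → p (c • x)) (hgen : ∀ i x, p x → p (gen i x)) (x : Lam) : p x := by
  have hw : ∀ L : List (Fin 3), p ((L.map gen).prod lamOne) := fun L => by
    induction L with
    | nil => exact one
    | cons j L ih => exact hgen j _ ih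
  have h0 : p 0 := by simpa using smul 0 _ one
  rw [← lmul_lamOne x]
  simp only [lmul, extMap_apply, LinearMap.sum_apply, LinearMap.smul_apply]
  exact Finset.sum_induction _ p add h0 fun I _ => smul _ _ (hw _)

/-! ### Functoriality of the exterior algebra in the matrix -/

/-- The images of the generators under a matrix. -/
def cols (R : Matrix (Fin 3) (Fin 3) ℂ) (j : Fin 3) : Module.End ℂ Lam := vec fun i => R i j

theorem cols_one : cols 1 = gen := by
  ext1 j
  simp [cols, vec, Matrix.one_apply]

theorem cols_anticomm (R : Matrix (Fin 3) (Fin 3) ℂ) (i j : Fin 3) :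
    cols R i * cols R j = -(cols R j * cols R i) := vec_anticomm _ _

theorem sum_smul_cols (R : Matrix (Fin 3) (Fin 3) ℂ) (w : Fin 3 → ℂ) :
    ∑ j, w j • cols R j = vec (R *ᵥ w) := by
  simp only [cols, vec, Finset.smul_sum, smul_smul, Matrix.mulVec, dotProduct, Finset.sum_smul]
  rw [Finset.sum_comm]
  simp only [mul_comm]

/-- The algebra homomorphism of the exterior algebra induced by a matrix, as operators of left
multiplication. -/
def rmap (R : Matrix (Fin 3) (Fin 3) ℂ) : Lam →ₗ[ℂ] Module.End ℂ Lam := extMap (cols R)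

theorem rmap_one : rmap 1 = lmul := by rw [rmap, lmul, cols_one]

theorem rmap_lamOne (R : Matrix (Fin 3) (Fin 3) ℂ) : rmap R lamOne = 1 := extMap_lamOne

theorem rmap_gen (R : Matrix (Fin 3) (Fin 3) ℂ) (i : Fin 3) (x : Lam) :
    rmap R (gen i x) = cols R i * rmap R x := extMap_gen (cols_anticomm R) i x

theorem rmap_vec (R : Matrix (Fin 3) (Fin 3) ℂ) (w : Fin 3 → ℂ) (x : Lam) :
    rmap R (vec w x) = vec (R *ᵥ w) * rmap R x := by
  rw [← sum_smul_cols]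
  simp only [vec, LinearMap.sum_apply, LinearMap.smul_apply, map_sum, map_smul, Finset.sum_mul,
    rmap_gen, smul_mul_assoc]

/-- One induction yields two facts: S = 1 says that Λ(R) is multiplicative, and v = `lamOne` says
that Λ(R)Λ(S) = Λ(RS). -/
theorem rmap_rmap (R S : Matrix (Fin 3) (Fin 3) ℂ) (z v : Lam) :
    rmap R (rmap S z v) = rmap (R * S) z * rmap R v := by
  induction z using lam_induction with
  | one => simp [rmap_lamOne]
  | add x y hx hy => simp [hx, hy, add_mul]
  | smul c x hx => simp [hx]
  | hgen i x hx =>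
    rw [rmap_gen, rmap_gen, Module.End.mul_apply, cols, rmap_vec, hx, mul_assoc]
    rfl

theorem rmap_lmul (R : Matrix (Fin 3) (Fin 3) ℂ) (z v : Lam) :
    rmap R (lmul z v) = rmap R z * rmap R v := by
  rw [← rmap_one, rmap_rmap, mul_one]

/-- The product `x ∧ R y` in the exterior algebra. -/
def wmul (R : Matrix (Fin 3) (Fin 3) ℂ) (x y : Lam) : Lam := lmul x (rmap R y lamOne)

theorem wmul_assoc (R S : Matrix (Fin 3) (Fin 3) ℂ) (x y z : Lam) :
    wmul R x (wmul S y z) = wmul (R * S) (wmul R x y) z := by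
  simp only [wmul, rmap_rmap, ← rmap_one, one_mul, mul_one, Module.End.mul_apply,
    rmap_lamOne]

/-! ### Grading, graded commutativity and the top degree -/

/-- The elements of degree `k` of the exterior algebra. -/
def lamDeg (k : ℕ) : Submodule ℂ Lam where
  carrier := {x | ∀ I, I.card ≠ k → x I = 0}
  zero_mem' := fun _ _ => rfl
  add_mem' := fun {x y} hx hy I h => by rw [Pi.add_apply, hx I h, hy I h, add_zero]
  smul_mem' := fun c x hx I h => by rw [Pi.smul_apply, hx I h, smul_zero]

theorem lamOne_mem : lamOne ∈ lamDeg 0 := fun I h =>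
  Pi.single_eq_of_ne (fun h0 => h (by rw [h0, Finset.card_empty])) _

theorem gen_mem {k : ℕ} {x : Lam} (hx : x ∈ lamDeg k) (i : Fin 3) : gen i x ∈ lamDeg (k + 1) := by
  intro I hI
  rw [gen_apply]
  split_ifs with h
  · rw [hx, mul_zero]
    rw [Finset.card_erase_of_mem h]
    have := Finset.card_pos.2 ⟨i, h⟩
    omega
  · rfl

theorem vec_mem {k : ℕ} {x : Lam} (hx : x ∈ lamDeg k) (w : Fin 3 → ℂ) :
    vec w x ∈ lamDeg (k + 1) := by
  simp only [vec, LinearMap.sum_apply, LinearMap.smul_apply]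
  exact Submodule.sum_mem _ fun i _ => Submodule.smul_mem _ _ (gen_mem hx i)

/-- Membership in a submodule is a linear condition, so it suffices to check words of length k.
Taking S to be operators landing in a given degree, or the locus where two linear maps agree, turns
degree and commutation statements into inductions on lists. -/
theorem extMap_mem_of_wordProd {A : Type*} [Ring A] [Algebra ℂ A] {c : Fin 3 → A}
    {S : Submodule ℂ A} {k : ℕ} (h : ∀ L : List (Fin 3), L.length = k → (L.map c).prod ∈ S)
    {x : Lam} (hx : x ∈ lamDeg k) : extMap c x ∈ S := by
  rw [extMap_apply]
  refine Submodule.sum_mem _ fun I _ => ?_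
  by_cases hI : I.card = k
  · exact Submodule.smul_mem _ _ (h _ (by simpa using hI))
  · rw [hx I hI, zero_smul]
    exact Submodule.zero_mem _

theorem rmap_mem {R : Matrix (Fin 3) (Fin 3) ℂ} {k l : ℕ} {x y : Lam} (hx : x ∈ lamDeg k)
    (hy : y ∈ lamDeg l) : rmap R x y ∈ lamDeg (k + l) := by
  refine extMap_mem_of_wordProd (S := (lamDeg (k + l)).comap (LinearMap.applyₗ y)) (fun L hL => ?_) hx
  clear hx
  subst hL
  simp only [Submodule.mem_comap, LinearMap.applyₗ_apply_apply]
  induction L with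
  | nil => simpa using hy
  | cons j L ih =>
    rw [List.map_cons, List.prod_cons, Module.End.mul_apply, List.length_cons, add_right_comm]
    exact vec_mem ih _

theorem wmul_mem {R : Matrix (Fin 3) (Fin 3) ℂ} {k l : ℕ} {x y : Lam} (hx : x ∈ lamDeg k)
    (hy : y ∈ lamDeg l) : wmul R x y ∈ lamDeg (k + l) := by
  rw [wmul, ← rmap_one]
  exact rmap_mem hx (rmap_mem hy lamOne_mem)

theorem vec_mul_rmap (R : Matrix (Fin 3) (Fin 3) ℂ) (w : Fin 3 → ℂ) {k : ℕ} {x : Lam}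
    (hx : x ∈ lamDeg k) : vec w * rmap R x = (-1 : ℂ) ^ k • (rmap R x * vec w) := by
  refine extMap_mem_of_wordProd (c := cols R) (S := LinearMap.eqLocus
    (LinearMap.mulLeft ℂ (vec w)) ((-1 : ℂ) ^ k • LinearMap.mulRight ℂ (vec w))) (fun L hL => ?_) hx
  clear hx
  subst hL
  simp only [LinearMap.mem_eqLocus, LinearMap.mulLeft_apply, LinearMap.smul_apply,
    LinearMap.mulRight_apply]
  induction L with
  | nil => simp
  | cons j L ih =>
    obtain ⟨u, hu⟩ : ∃ u, cols R j = vec u := ⟨_, rfl⟩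
    have hneg : ∀ a : Module.End ℂ Lam, vec w * (vec u * a) = -(vec u * (vec w * a)) := fun a =>
      LinearMap.ext fun y => LinearMap.congr_fun (vec_anticomm w u) (a y)
    rw [List.map_cons, List.prod_cons, hu, hneg, ih, List.length_cons, pow_succ, mul_smul_comm,
      mul_assoc, mul_neg_one, neg_smul]

theorem rmap_mul_rmap (R S : Matrix (Fin 3) (Fin 3) ℂ) {k l : ℕ} {x y : Lam}
    (hx : x ∈ lamDeg k) (hy : y ∈ lamDeg l) :
    rmap R x * rmap S y = (-1 : ℂ) ^ (k * l) • (rmap S y * rmap R x) := by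
  refine extMap_mem_of_wordProd (c := cols R) (S := LinearMap.eqLocus
    (LinearMap.mulRight ℂ (rmap S y)) ((-1 : ℂ) ^ (k * l) • LinearMap.mulLeft ℂ (rmap S y)))
    (fun L hL => ?_) hx
  clear hx
  subst hL
  simp only [LinearMap.mem_eqLocus, LinearMap.mulLeft_apply, LinearMap.smul_apply,
    LinearMap.mulRight_apply]
  induction L with
  | nil => simp
  | cons j L ih =>
    obtain ⟨u, hu⟩ : ∃ u, cols R j = vec u := ⟨_, rfl⟩
    rw [List.map_cons, List.prod_cons, mul_assoc, ih, mul_smul_comm, ← mul_assoc, hu,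
      vec_mul_rmap S _ hy, List.length_cons, add_mul, one_mul, pow_add, smul_mul_assoc, smul_smul,
      mul_assoc]

theorem rmap_top (R : Matrix (Fin 3) (Fin 3) ℂ) {x : Lam} (hx : x ∈ lamDeg 3) :
    rmap R x lamOne Finset.univ = R.det * x Finset.univ := by
  have hu : (Finset.univ : Finset (Fin 3)) = {0, 1, 2} := by decide
  have e7 : ({0, 1, 2} : Finset (Fin 3)).erase 0 = {1, 2} := by decide
  have e8 : ({0, 1, 2} : Finset (Fin 3)).erase 1 = {0, 2} := by decide
  have e9 : ({0, 1, 2} : Finset (Fin 3)).erase 2 = {0, 1} := by decide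
  have e1 : ({0, 1} : Finset (Fin 3)).erase 0 = {1} := by decide
  have e2 : ({0, 1} : Finset (Fin 3)).erase 1 = {0} := by decide
  have e3 : ({0, 2} : Finset (Fin 3)).erase 0 = {2} := by decide
  have e4 : ({0, 2} : Finset (Fin 3)).erase 2 = {0} := by decide
  have e5 : ({1, 2} : Finset (Fin 3)).erase 1 = {2} := by decide
  have e6 : ({1, 2} : Finset (Fin 3)).erase 2 = {1} := by decide
  have n : ∀ i (y : Lam), gen i y {i} = y ∅ := fun i y => by
    have : ({i} : Finset (Fin 3)).filter (· < i) = ∅ := by simp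
    simp [gen_apply, this]
  have n' : ∀ i j (y : Lam), i ≠ j → gen i y {j} = 0 := fun i j y h => by
    simp [gen_apply, h]
  have h01 : ∀ i (y : Lam), gen i y {0, 1} = ![y {1}, -y {0}, 0] i := fun i y => by
    have h0 : (({0, 1} : Finset (Fin 3)).filter (· < 0)).card = 0 := by decide
    have h1 : (({0, 1} : Finset (Fin 3)).filter (· < 1)).card = 1 := by decide
    obtain rfl | rfl | rfl : i = 0 ∨ i = 1 ∨ i = 2 := by fin_cases i <;> simp
    all_goals simp only [gen_apply, e1, e2, h0, h1]; simp
  have h02 : ∀ i (y : Lam), gen i y {0, 2} = ![y {2}, 0, -y {0}] i := fun i y => by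
    have h0 : (({0, 2} : Finset (Fin 3)).filter (· < 0)).card = 0 := by decide
    have h1 : (({0, 2} : Finset (Fin 3)).filter (· < 2)).card = 1 := by decide
    obtain rfl | rfl | rfl : i = 0 ∨ i = 1 ∨ i = 2 := by fin_cases i <;> simp
    all_goals simp only [gen_apply, e3, e4, h0, h1]; simp
  have h12 : ∀ i (y : Lam), gen i y {1, 2} = ![0, y {2}, -y {1}] i := fun i y => by
    have h0 : (({1, 2} : Finset (Fin 3)).filter (· < 1)).card = 0 := by decide
    have h1 : (({1, 2} : Finset (Fin 3)).filter (· < 2)).card = 1 := by decide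
    obtain rfl | rfl | rfl : i = 0 ∨ i = 1 ∨ i = 2 := by fin_cases i <;> simp
    all_goals simp only [gen_apply, e5, e6, h0, h1]; simp
  have h012 : ∀ i (y : Lam), gen i y {0, 1, 2} = ![y {1, 2}, -y {0, 2}, y {0, 1}] i := fun i y => by
    have h0 : (({0, 1, 2} : Finset (Fin 3)).filter (· < 0)).card = 0 := by decide
    have h1 : (({0, 1, 2} : Finset (Fin 3)).filter (· < 1)).card = 1 := by decide
    have h2 : (({0, 1, 2} : Finset (Fin 3)).filter (· < 2)).card = 2 := by decide
    obtain rfl | rfl | rfl : i = 0 ∨ i = 1 ∨ i = 2 := by fin_cases i <;> simp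
    all_goals simp only [gen_apply, e7, e8, e9, h0, h1, h2]; simp
  -- In degree three only the top monomial survives. Its image is the wedge of the three columns of
  -- R, whose coefficient is the expansion of the determinant.
  have hs : rmap R x lamOne = x {0, 1, 2} • cols R 0 (cols R 1 (cols R 2 lamOne)) := by
    rw [rmap, extMap_eq, hx ∅ (by decide), hx {0} (by decide), hx {1} (by decide),
      hx {2} (by decide), hx {0, 1} (by decide), hx {0, 2} (by decide), hx {1, 2} (by decide)]
    simp
  rw [hs, hu, Matrix.det_fin_three]
  simp only [cols, vec, Fin.sum_univ_three, LinearMap.add_apply, LinearMap.smul_apply, Pi.add_apply,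
    Pi.smul_apply, h012, h01, h02, h12, smul_eq_mul]
  simp [n, n', lamOne]
  ring

/-- Applying Λ(R) does not change the top coefficient, as det R = 1, and turns x ∧ Sy into Rx ∧ y.
Graded commutativity then gives y ∧ Rx up to the sign. -/
theorem wmul_twisted_comm {R S : Matrix (Fin 3) (Fin 3) ℂ} (hRS : R * S = 1) (hR : R.det = 1)
    {k l : ℕ} (hkl : k + l = 3) {x y : Lam} (hx : x ∈ lamDeg k) (hy : y ∈ lamDeg l) :
    wmul S x y Finset.univ = (-1 : ℂ) ^ (k * l) * wmul R y x Finset.univ := by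
  have h := rmap_top R (hkl ▸ wmul_mem (R := S) hx hy)
  rw [hR, one_mul] at h
  rw [← h, wmul, rmap_lmul, rmap_rmap, hRS, rmap_lamOne, mul_one, rmap_one, ← rmap_one,
    rmap_mul_rmap R 1 hx hy, wmul, rmap_one]
  rfl

/-- The pointwise Leibniz rule: v multiplies x directly, while Rw is moved past x at the cost of a
sign and absorbed as Λ(R)(w ∧ y). The shape v + Rw is that of the cocycle identity. -/
theorem vec_wmul (R : Matrix (Fin 3) (Fin 3) ℂ) (v w : Fin 3 → ℂ) {k : ℕ} {x : Lam}
    (hx : x ∈ lamDeg k) (y : Lam) :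
    vec (v + R *ᵥ w) (wmul R x y) = wmul R (vec v x) y + (-1 : ℂ) ^ k • wmul R x (vec w y) := by
  have h := congrArg (fun A : Module.End ℂ Lam => A (rmap R y lamOne)) (vec_mul_rmap 1 (R *ᵥ w) hx)
  have hv : ∀ a b, vec (a + b) = vec a + vec b := fun a b => by
    simp [vec, add_smul, Finset.sum_add_distrib]
  simp only [Module.End.mul_apply, LinearMap.smul_apply, rmap_one] at h
  rw [hv, LinearMap.add_apply]
  simp only [wmul, lmul_vec, rmap_vec, Module.End.mul_apply, h]

theorem vec_vec (w : Fin 3 → ℂ) (x : Lam) : vec w (vec w x) = 0 := by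
  have h := congrArg (fun A : Module.End ℂ Lam => A x) (vec_anticomm w w)
  simp only [Module.End.mul_apply, LinearMap.neg_apply] at h
  exact self_eq_neg.1 h

/-! ### Symbols of the bimodule structure and of the differential -/

/-- The symbol of `rho`; a representation of the affine group. -/
def rmat (κ : ℝ) (q : ℝ × ℝ) : Matrix (Fin 3) (Fin 3) ℂ :=
  !![1, 2 * q.2 / κ * Complex.exp (-(q.1 / κ)), 0;
    0, Complex.exp (-(q.1 / κ)), 0;
    q.2 / κ, (q.2 / κ) ^ 2 * Complex.exp (-(q.1 / κ)), Complex.exp (q.1 / κ)]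

/-- The symbol of `D`; a cocycle for the representation `rmat`. -/
def dvec (κ : ℝ) (q : ℝ × ℝ) : Fin 3 → ℂ :=
  ![-Complex.I * q.2 * Complex.exp (-(q.1 / κ)),
    -Complex.I * κ / 2 * (Complex.exp (-(q.1 / κ)) - 1),
    1 / 2 * (-(Complex.I / κ) * q.2 ^ 2 * Complex.exp (-(q.1 / κ)) +
      Complex.I * κ * (Complex.exp (q.1 / κ) - 1))]

section Symbols

variable {κ : ℝ} (hκ : κ ≠ 0)

theorem rmat_zero : rmat κ 0 = 1 := by
  ext i j
  fin_cases i <;> fin_cases j <;> simp [rmat]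

theorem dvec_zero : dvec κ 0 = 0 := by
  ext i
  fin_cases i <;> simp [dvec]

theorem rmat_det (q : ℝ × ℝ) : (rmat κ q).det = 1 := by
  have : Complex.exp (-(q.1 / κ)) * Complex.exp (q.1 / κ) = 1 := by
    rw [← Complex.exp_add]; simp
  simp [rmat, Matrix.det_fin_three, this]

include hκ

theorem rmat_gmul (q s : ℝ × ℝ) : rmat κ (gmul κ q s) = rmat κ q * rmat κ s := by
  have hκ' : (κ : ℂ) ≠ 0 := by exact_mod_cast hκ
  have e1 : Complex.exp (-((q.1 + s.1) / κ)) = Complex.exp (-(q.1 / κ)) * Complex.exp (-(s.1 / κ)) := by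
    rw [← Complex.exp_add]; congr 1; ring
  have e2 : Complex.exp ((q.1 + s.1) / κ) = Complex.exp (q.1 / κ) * Complex.exp (s.1 / κ) := by
    rw [← Complex.exp_add]; congr 1; ring
  have e3 : Complex.exp (-(q.1 / κ)) * Complex.exp (q.1 / κ) = 1 := by
    rw [← Complex.exp_add]; simp
  ext i j
  fin_cases i <;> fin_cases j <;>
    simp [rmat, gmul, Matrix.mul_apply, Fin.sum_univ_three, e1, e2, -mul_eq_mul_left_iff, -mul_eq_mul_right_iff]
  · field_simp
    linear_combination s.2 * e3
  · ring
  · field_simp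
    linear_combination (2 * q.2 * s.2 + s.2 ^ 2 * Complex.exp (q.1 / κ)) * e3

/-- The cocycle identity is the Leibniz rule for functions in terms of symbols. -/
theorem dvec_gmul (q s : ℝ × ℝ) : dvec κ (gmul κ q s) = dvec κ q + rmat κ q *ᵥ dvec κ s := by
  have hκ' : (κ : ℂ) ≠ 0 := by exact_mod_cast hκ
  have e1 : Complex.exp (-((q.1 + s.1) / κ)) = Complex.exp (-(q.1 / κ)) * Complex.exp (-(s.1 / κ)) := by
    rw [← Complex.exp_add]; congr 1; ring
  have e2 : Complex.exp ((q.1 + s.1) / κ) = Complex.exp (q.1 / κ) * Complex.exp (s.1 / κ) := by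
    rw [← Complex.exp_add]; congr 1; ring
  have e3 : Complex.exp (-(q.1 / κ)) * Complex.exp (q.1 / κ) = 1 := by
    rw [← Complex.exp_add]; simp
  ext i
  fin_cases i <;>
    simp [rmat, dvec, gmul, e1, e2]
  · field_simp
    linear_combination (-(s.2 * Complex.exp (-(s.1 / κ)))) * e3
  · ring
  · field_simp
    linear_combination (-(2 * q.2 * s.2 * Complex.exp (-(s.1 / κ)) +
      s.2 ^ 2 * Complex.exp (q.1 / κ) * Complex.exp (-(s.1 / κ)))) * e3

theorem rmat_mul_ginv (q : ℝ × ℝ) : rmat κ q * rmat κ (ginv κ q) = 1 := by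
  rw [← rmat_gmul hκ, gmul_ginv, rmat_zero]

end Symbols

/-! ### Smoothness of the symbols and their action on transforms -/

theorem contDiff_cexp_fst (a : ℂ) : ContDiff ℝ ∞ fun q : ℝ × ℝ => Complex.exp (a * q.1) :=
  (contDiff_const.mul (Complex.ofRealCLM.contDiff.comp contDiff_fst)).cexp

theorem contDiff_ofReal_snd : ContDiff ℝ ∞ fun q : ℝ × ℝ => (q.2 : ℂ) :=
  Complex.ofRealCLM.contDiff.comp contDiff_snd

theorem contDiff_rmat (κ : ℝ) (i j : Fin 3) : ContDiff ℝ ∞ fun q => rmat κ q i j := by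
  have e1 : ContDiff ℝ ∞ fun q : ℝ × ℝ => Complex.exp (-(q.1 / κ)) := by
    convert contDiff_cexp_fst (-(κ : ℂ)⁻¹) using 3; ring
  have e2 : ContDiff ℝ ∞ fun q : ℝ × ℝ => Complex.exp (q.1 / κ) := by
    convert contDiff_cexp_fst ((κ : ℂ)⁻¹) using 3; ring
  have e3 := contDiff_ofReal_snd
  fin_cases i <;> fin_cases j <;> simp [rmat]
  · exact contDiff_const
  · fun_prop
  · exact contDiff_const
  · exact contDiff_const
  · fun_prop
  · exact contDiff_const
  · fun_prop
  · fun_prop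
  · fun_prop

theorem contDiff_dvec (κ : ℝ) (i : Fin 3) : ContDiff ℝ ∞ fun q => dvec κ q i := by
  have e1 : ContDiff ℝ ∞ fun q : ℝ × ℝ => Complex.exp (-(q.1 / κ)) := by
    convert contDiff_cexp_fst (-(κ : ℂ)⁻¹) using 3; ring
  have e2 : ContDiff ℝ ∞ fun q : ℝ × ℝ => Complex.exp (q.1 / κ) := by
    convert contDiff_cexp_fst ((κ : ℂ)⁻¹) using 3; ring
  have e3 := contDiff_ofReal_snd
  fin_cases i <;> simp [dvec] <;> fun_prop

section Action

variable {h : ℝ × ℝ → ℂ} (h1 : ContDiff ℝ ∞ h) (h2 : HasCompactSupport h)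
include h1 h2

theorem Einv_fourier (κ : ℝ) :
    Einv κ (fourier h) = fourier fun q => Complex.exp (-(q.1 / κ)) * h q := by
  rw [Einv, T_fourier h1 h2]
  congr 1; ext q; congr 2; push_cast; ring

theorem E_fourier (κ : ℝ) :
    E κ (fourier h) = fourier fun q => Complex.exp (q.1 / κ) * h q := by
  rw [E, T_fourier h1 h2]
  congr 1; ext q; congr 2; push_cast; ring

theorem fourier_sub_self {a : ℝ × ℝ → ℂ} (ha : ContDiff ℝ ∞ a) :
    fourier (fun q => a q * h q) - fourier h = fourier fun q => (a q - 1) * h q := by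
  have := fourier_add (ha.mul h1) h2.mul_left
    (contDiff_const.mul h1 : ContDiff ℝ ∞ fun q => (-1 : ℂ) * h q) h2.mul_left
  rw [fourier_smul, neg_one_smul, ← sub_eq_add_neg] at this
  rw [← this]
  congr 1; ext q; ring

theorem rho_fourier (κ : ℝ) (i j : Fin 3) :
    rho κ i j (fourier h) = fourier fun q => rmat κ q i j * h q := by
  have p1 : ContDiff ℝ ∞ fun q : ℝ × ℝ => (-Complex.I * q.2) * h q :=
    (contDiff_const.mul contDiff_ofReal_snd).mul h1
  have p2 : HasCompactSupport fun q : ℝ × ℝ => (-Complex.I * q.2) * h q := h2.mul_left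
  have p3 : ContDiff ℝ ∞ fun q : ℝ × ℝ => (-Complex.I * q.2) * ((-Complex.I * q.2) * h q) :=
    (contDiff_const.mul contDiff_ofReal_snd).mul p1
  have p4 : HasCompactSupport fun q : ℝ × ℝ => (-Complex.I * q.2) * ((-Complex.I * q.2) * h q) :=
    p2.mul_left
  fin_cases i <;> fin_cases j <;>
    simp only [rho, P_fourier h1 h2, P_fourier p1 p2, Einv_fourier h1 h2, Einv_fourier p1 p2,
      Einv_fourier p3 p4, E_fourier h1 h2, ← fourier_smul] <;> simp [rmat]
  · congr 1; ext q
    linear_combination (-(2 / κ * Complex.exp (-(q.1 / κ)) * q.2 * h q)) * Complex.I_mul_I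
  · congr 1; ext q
    linear_combination (-(1 / κ * q.2 * h q)) * Complex.I_mul_I
  · congr 1; ext q
    linear_combination (-(1 / (κ : ℂ) ^ 2 * Complex.exp (-(q.1 / κ)) * q.2 ^ 2 * h q)) * Complex.I_mul_I

theorem D_fourier (κ : ℝ) (i : Fin 3) :
    D κ i (fourier h) = fourier fun q => dvec κ q i * h q := by
  have p1 : ContDiff ℝ ∞ fun q : ℝ × ℝ => (-Complex.I * q.2) * h q :=
    (contDiff_const.mul contDiff_ofReal_snd).mul h1
  have p2 : HasCompactSupport fun q : ℝ × ℝ => (-Complex.I * q.2) * h q := h2.mul_left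
  have p3 : ContDiff ℝ ∞ fun q : ℝ × ℝ => (-Complex.I * q.2) * ((-Complex.I * q.2) * h q) :=
    (contDiff_const.mul contDiff_ofReal_snd).mul p1
  have p4 : HasCompactSupport fun q : ℝ × ℝ => (-Complex.I * q.2) * ((-Complex.I * q.2) * h q) :=
    p2.mul_left
  have e1 : ContDiff ℝ ∞ fun q : ℝ × ℝ => Complex.exp (-(q.1 / κ)) := by
    convert contDiff_cexp_fst (-(κ : ℂ)⁻¹) using 3; ring
  have e2 : ContDiff ℝ ∞ fun q : ℝ × ℝ => Complex.exp (q.1 / κ) := by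
    convert contDiff_cexp_fst ((κ : ℂ)⁻¹) using 3; ring
  fin_cases i <;>
    simp only [D, P_fourier h1 h2, P_fourier p1 p2, Einv_fourier h1 h2, Einv_fourier p1 p2,
      Einv_fourier p3 p4, E_fourier h1 h2, fourier_sub_self h1 h2 e1, fourier_sub_self h1 h2 e2,
      ← fourier_smul]
  · congr 1; ext q; simp [dvec]; ring
  · congr 1; ext q; simp [dvec]; ring
  · rw [← fourier_add (contDiff_const.mul (e1.mul p3)) p4.mul_left.mul_left
      (contDiff_const.mul ((e2.sub contDiff_const).mul h1)) h2.mul_left.mul_left, ← fourier_smul]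
    congr 1; ext q; simp [dvec]
    linear_combination (1 / 2 * (Complex.I / κ * Complex.exp (-(q.1 / κ)) * q.2 ^ 2 * h q)) *
      Complex.I_mul_I

end Action

/-! ### Forms as Fourier transforms of functions with values in the exterior algebra -/

/-- Smooth compactly supported functions with values in the exterior algebra. -/
structure IsTest (h : ℝ × ℝ → Lam) : Prop where
  smooth : ContDiff ℝ ∞ h
  compact : HasCompactSupport h

/-- The Fourier transform of all coefficient functions. -/
def fourierForm (h : ℝ × ℝ → Lam) : Form := fun I => fourier fun q => h q I

namespace IsTest

variable {h k : ℝ × ℝ → Lam}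

theorem smooth_apply (hh : IsTest h) (I : Finset (Fin 3)) : ContDiff ℝ ∞ fun q => h q I :=
  contDiff_pi.1 hh.smooth I

theorem compact_apply (hh : IsTest h) (I : Finset (Fin 3)) : HasCompactSupport fun q => h q I :=
  hh.compact.comp_left (g := fun x : Lam => x I) rfl

theorem of_apply (h1 : ∀ I, ContDiff ℝ ∞ fun q => h q I)
    (h2 : ∀ I, HasCompactSupport fun q => h q I) : IsTest h := by
  refine ⟨contDiff_pi.2 h1, HasCompactSupport.intro
    (isCompact_iUnion fun I => (h2 I).isCompact) fun q hq => funext fun I => ?_⟩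
  exact image_eq_zero_of_notMem_tsupport (f := fun q => h q I)
    fun hm => hq (Set.mem_iUnion.2 ⟨I, hm⟩)

theorem add (hh : IsTest h) (hk : IsTest k) : IsTest fun q => h q + k q :=
  ⟨hh.smooth.add hk.smooth, hh.compact.add hk.compact⟩

theorem zero : IsTest fun _ => 0 := ⟨contDiff_const, HasCompactSupport.zero⟩

theorem mul {a : ℝ × ℝ → ℂ} (ha : ContDiff ℝ ∞ a) (hh : IsTest h) : IsTest fun q => a q • h q :=
  of_apply (fun I => ha.mul (hh.smooth_apply I)) fun I => (hh.compact_apply I).mul_left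

theorem map (hh : IsTest h) (A : Module.End ℂ Lam) : IsTest fun q => A (h q) :=
  ⟨((A.restrictScalars ℝ).toContinuousLinearMap.contDiff).comp hh.smooth,
    hh.compact.comp_left (map_zero A)⟩

theorem sum {ι : Type*} (s : Finset ι) {h : ι → ℝ × ℝ → Lam} (hh : ∀ i, IsTest (h i)) :
    IsTest fun q => ∑ i ∈ s, h i q := by
  classical
  induction s using Finset.induction_on with
  | empty => simpa using zero
  | insert i s hi ih => simpa [Finset.sum_insert hi] using (hh i).add ih

theorem vec {w : ℝ × ℝ → Fin 3 → ℂ} (hw : ∀ i, ContDiff ℝ ∞ fun q => w q i) (hh : IsTest h) :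
    IsTest fun q => KappaMinkowski.vec (w q) (h q) := by
  simp only [KappaMinkowski.vec, LinearMap.sum_apply, LinearMap.smul_apply]
  exact sum _ fun i => (hh.map (gen i)).mul (hw i)

theorem cols {M : ℝ × ℝ → Matrix (Fin 3) (Fin 3) ℂ} (hM : ∀ i j, ContDiff ℝ ∞ fun q => M q i j)
    (hh : IsTest h) (L : List (Fin 3)) :
    IsTest fun q => (L.map (KappaMinkowski.cols (M q))).prod (h q) := by
  induction L with
  | nil => simpa using hh
  | cons j L ih => exact ih.vec fun i => hM i j

theorem single {f : ℝ × ℝ → ℂ} (h1 : ContDiff ℝ ∞ f) (h2 : HasCompactSupport f)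
    (x : Lam) : IsTest fun q => f q • x :=
  ⟨h1.smul contDiff_const, h2.smul_right⟩

end IsTest

theorem fourierForm_add {h k : ℝ × ℝ → Lam} (hh : IsTest h) (hk : IsTest k) :
    fourierForm (fun q => h q + k q) = fourierForm h + fourierForm k :=
  funext fun I => fourier_add (hh.smooth_apply I) (hh.compact_apply I) (hk.smooth_apply I)
    (hk.compact_apply I)

theorem fourierForm_smul (c : ℂ) (h : ℝ × ℝ → Lam) :
    fourierForm (fun q => c • h q) = c • fourierForm h :=
  funext fun I => fourier_smul c fun q => h q I

theorem fourierForm_sum {ι : Type*} (s : Finset ι) {h : ι → ℝ × ℝ → Lam}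
    (hh : ∀ i, IsTest (h i)) :
    fourierForm (fun q => ∑ i ∈ s, h i q) = ∑ i ∈ s, fourierForm (h i) := by
  ext1 I
  rw [Finset.sum_apply]
  simp only [fourierForm, Finset.sum_apply]
  exact fourier_sum s (fun i => (hh i).smooth_apply I) fun i => (hh i).compact_apply I

theorem ofFun_fourier (f : ℝ × ℝ → ℂ) :
    ofFun (fourier f) = fourierForm fun q => f q • lamOne := by
  ext1 I
  simp only [ofFun, fourierForm, lamOne]
  by_cases hI : I = ∅
  · subst hI; simp
  · simp [hI]

theorem genWedge_fourierForm (i : Fin 3) (h : ℝ × ℝ → Lam) :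
    genWedge i (fourierForm h) = fourierForm fun q => gen i (h q) := by
  ext1 I
  simp only [genWedge, fourierForm, gen_apply]
  split_ifs
  · rw [fourier_smul]
  · rw [fourier_zero]

theorem wordWedge_fourierForm (L : List (Fin 3)) (h : ℝ × ℝ → Lam) :
    wordWedge L (fourierForm h) = fourierForm fun q => (L.map gen).prod (h q) := by
  induction L with
  | nil => rfl
  | cons j L ih =>
    change genWedge j (wordWedge L (fourierForm h)) = _
    rw [ih, genWedge_fourierForm]
    rfl

/-- Moving a function past ψ_j multiplies its symbol by the j-th column of R(q). For a word this
gives, pointwise in q, the wedge of the corresponding columns, that is Λ(R(q)) applied to the word.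
-/
theorem funWord_fourier (κ : ℝ) (L : List (Fin 3)) {f : ℝ × ℝ → ℂ} (h1 : ContDiff ℝ ∞ f)
    (h2 : HasCompactSupport f) : funWord κ L (fourier f) =
      fourierForm fun q => f q • (L.map (cols (rmat κ q))).prod lamOne := by
  induction L generalizing f with
  | nil => simpa [funWord] using ofFun_fourier f
  | cons j L ih =>
    simp only [funWord, rho_fourier h1 h2]
    have t : ∀ i, IsTest fun q => (rmat κ q i j * f q) • (L.map (cols (rmat κ q))).prod lamOne := by
      intro i
      have := (IsTest.single ((contDiff_rmat κ i j).mul h1) h2.mul_left lamOne).cols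
        (contDiff_rmat κ) L
      simpa only [map_smul] using this
    simp only [fun i => ih ((contDiff_rmat κ i j).mul h1) h2.mul_left, genWedge_fourierForm]
    rw [← fourierForm_sum _ fun i => (t i).map (gen i)]
    congr 1
    ext1 q
    rw [List.map_cons, List.prod_cons, Module.End.mul_apply]
    simp only [cols, vec, LinearMap.sum_apply, LinearMap.smul_apply, Finset.smul_sum, map_smul,
      smul_smul, mul_comm]

theorem dForm_fourierForm (κ : ℝ) {h : ℝ × ℝ → Lam} (hh : IsTest h) :
    dForm κ (fourierForm h) = fourierForm fun q => vec (dvec κ q) (h q) := by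
  have e : ∀ I, dFun κ (fourierForm h I) =
      fourierForm fun q => vec (dvec κ q) (h q I • lamOne) := by
    intro I
    have h1 := hh.smooth_apply I
    have h2 := hh.compact_apply I
    simp only [dFun, fourierForm, D_fourier h1 h2]
    change ∑ i, genWedge i (ofFun (fourier fun q => dvec κ q i * h q I)) = _
    simp only [ofFun_fourier, genWedge_fourierForm]
    rw [← fourierForm_sum _ fun i =>
      (IsTest.single ((contDiff_dvec κ i).mul h1) h2.mul_left lamOne).map (gen i)]
    congr 1
    ext1 q
    simp only [vec, LinearMap.sum_apply, LinearMap.smul_apply, map_smul, smul_smul,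
      Finset.smul_sum, mul_comm]
  simp only [dForm, e, wordWedge_fourierForm, ← fourierForm_smul]
  rw [← fourierForm_sum]
  · congr 1
    ext1 q
    -- The sign (-1)^|I| in `dForm` is exactly the cost of moving the vector w(q) from the right of
    -- ψ_I to its left, so d becomes left multiplication.
    have hs : ∀ I : Finset (Fin 3), vec (dvec κ q) (wordProd gen I lamOne) =
        (-1 : ℂ) ^ I.card • wordProd gen I (vec (dvec κ q) lamOne) := by
      intro I
      have hI : wordProd gen I = rmap 1 (Pi.single I 1) := by
        rw [rmap_one, lmul, extMap_apply, Finset.sum_eq_single I]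
        · simp
        · intro J _ hJ; simp [hJ]
        · simp
      have := vec_mul_rmap 1 (dvec κ q) (k := I.card) (x := Pi.single I 1)
        (fun J hJ => Pi.single_eq_of_ne (fun e => hJ (by rw [e])) _)
      rw [← hI] at this
      exact LinearMap.congr_fun this lamOne
    conv_rhs => rw [← lmul_lamOne (h q), lmul, extMap_apply]
    simp only [LinearMap.sum_apply, LinearMap.smul_apply, map_sum, map_smul, hs]
    refine Finset.sum_congr rfl fun I _ => ?_
    rw [smul_comm]
    rfl
  · intro I
    exact ((((IsTest.single (hh.smooth_apply I) (hh.compact_apply I) lamOne).vec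
      (contDiff_dvec κ)).map _).mul contDiff_const)

theorem TForm_fourierForm (γ : ℝ) {h : ℝ × ℝ → Lam} (hh : IsTest h) :
    TForm γ (fourierForm h) = fourierForm fun q => Complex.exp (γ * q.1) • h q :=
  funext fun I => T_fourier (hh.smooth_apply I) (hh.compact_apply I) γ

theorem intForm_fourierForm {h : ℝ × ℝ → Lam} (hh : IsTest h) :
    intForm (fourierForm h) = 2 * Real.pi * h 0 Finset.univ :=
  integral_fourier (hh.smooth_apply _) (hh.compact_apply _)

theorem mem_Omega_iff {k : ℕ} {η : Form} :
    η ∈ Omega k ↔ ∃ h, IsTest h ∧ (∀ q, h q ∈ lamDeg k) ∧ η = fourierForm h := by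
  constructor
  · intro hη
    choose h h1 h2 h3 using fun I => (hη I).1
    -- The chosen preimages are replaced by zero outside degree k, so that the symbol itself is
    -- homogeneous at every point.
    refine ⟨fun q I => if I.card = k then h I q else 0, IsTest.of_apply (fun I => ?_) (fun I => ?_),
      fun q I hI => if_neg hI, funext fun I => ?_⟩
    · by_cases hI : I.card = k
      · simpa [hI] using h1 I
      · simpa [hI] using contDiff_const
    · by_cases hI : I.card = k
      · simpa [hI] using h2 I
      · simp only [hI, if_false]
        exact HasCompactSupport.zero
    · by_cases hI : I.card = k
      · simp only [fourierForm, hI, if_true]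
        exact h3 I
      · simp only [fourierForm, hI, if_false, fourier_zero]
        exact (hη I).2 hI
  · rintro ⟨h, hh, hd, rfl⟩ I
    refine ⟨B_mem (hh.smooth_apply I) (hh.compact_apply I), fun hI => ?_⟩
    simp only [fourierForm, fun q => hd q I hI, fourier_zero]

/-! ### The product of forms as a convolution -/

/-- The convolution of functions with values in the exterior algebra, twisted by `rmat`. -/
def wconv (κ : ℝ) (h k : ℝ × ℝ → Lam) (p : ℝ × ℝ) : Lam :=
  (1 / (2 * (Real.pi : ℂ))) •
    ∫ q : ℝ × ℝ, Real.exp (-q.1 / κ) • wmul (rmat κ q) (h q) (k (gmul κ (ginv κ q) p))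

theorem wmul_eq_sum (R : Matrix (Fin 3) (Fin 3) ℂ) (x y : Lam) :
    wmul R x y = ∑ I, ∑ J, wordProd gen I ((x I * y J) • wordProd (cols R) J lamOne) := by
  simp only [wmul, lmul, rmap, extMap_apply, LinearMap.sum_apply, LinearMap.smul_apply, map_sum,
    map_smul, Finset.smul_sum, smul_smul]
  rw [Finset.sum_comm]
  simp only [mul_comm]

theorem continuous_cols_prod {X : Type*} [TopologicalSpace X] {M : X → Matrix (Fin 3) (Fin 3) ℂ}
    (hM : Continuous M) {x : X → Lam} (hx : Continuous x) (L : List (Fin 3)) :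
    Continuous fun a => (L.map (cols (M a))).prod (x a) := by
  induction L with
  | nil => simpa using hx
  | cons j L ih =>
    simp only [List.map_cons, List.prod_cons, Module.End.mul_apply, cols, vec,
      LinearMap.sum_apply, LinearMap.smul_apply]
    refine continuous_finsetSum _ fun i _ => ?_
    exact (hM.matrix_elem i j).smul ((gen i).continuous_of_finiteDimensional.comp ih)

theorem continuous_wmul {X : Type*} [TopologicalSpace X] {M : X → Matrix (Fin 3) (Fin 3) ℂ}
    (hM : Continuous M) {x y : X → Lam} (hx : Continuous x) (hy : Continuous y) :
    Continuous fun a => wmul (M a) (x a) (y a) := by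
  simp only [wmul_eq_sum]
  refine continuous_finsetSum _ fun I _ => continuous_finsetSum _ fun J _ => ?_
  refine (wordProd gen I).continuous_of_finiteDimensional.comp
    (Continuous.smul (f := fun a => x a I * y a J) ?_ ?_)
  · exact ((continuous_apply I).comp hx).mul ((continuous_apply J).comp hy)
  · exact continuous_cols_prod hM continuous_const _

theorem continuous_rmat (κ : ℝ) : Continuous (rmat κ) :=
  continuous_matrix fun i j => (contDiff_rmat κ i j).continuous

theorem wmul_zero_left (R : Matrix (Fin 3) (Fin 3) ℂ) (y : Lam) : wmul R 0 y = 0 := by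
  simp [wmul]

theorem wmul_zero_right (R : Matrix (Fin 3) (Fin 3) ℂ) (x : Lam) : wmul R x 0 = 0 := by
  simp [wmul]

/-- The operation `y ↦ x ∧ R y` as a linear map. -/
def wmulRight (R : Matrix (Fin 3) (Fin 3) ℂ) (x : Lam) : Module.End ℂ Lam :=
  lmul x * (rmap R).flip lamOne

theorem wmulRight_apply (R : Matrix (Fin 3) (Fin 3) ℂ) (x y : Lam) :
    wmulRight R x y = wmul R x y := rfl

/-- The operation `x ↦ x ∧ R y` as a linear map. -/
def wmulLeft (R : Matrix (Fin 3) (Fin 3) ℂ) (y : Lam) : Module.End ℂ Lam :=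
  lmul.flip (rmap R y lamOne)

theorem wmulLeft_apply (R : Matrix (Fin 3) (Fin 3) ℂ) (x y : Lam) :
    wmulLeft R y x = wmul R x y := rfl

theorem integral_end {X : Type*} [MeasurableSpace X] {μ : Measure X} (A : Module.End ℂ Lam)
    {f : X → Lam} (hf : Integrable f μ) : ∫ x, A (f x) ∂μ = A (∫ x, f x ∂μ) :=
  (LinearMap.toContinuousLinearMap A).integral_comp_comm hf

theorem integrable_end {X : Type*} [MeasurableSpace X] {μ : Measure X} (A : Module.End ℂ Lam)
    {f : X → Lam} (hf : Integrable f μ) : Integrable (fun x => A (f x)) μ :=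
  (LinearMap.toContinuousLinearMap A).integrable_comp hf

theorem wmul_smul_left (R : Matrix (Fin 3) (Fin 3) ℂ) (c : ℂ) (x y : Lam) :
    wmul R (c • x) y = c • wmul R x y := (wmulLeft R y).map_smul c x

theorem wmul_smul_right (R : Matrix (Fin 3) (Fin 3) ℂ) (c : ℂ) (x y : Lam) :
    wmul R x (c • y) = c • wmul R x y := (wmulRight R x).map_smul c y

theorem wmul_ofReal_smul_left (R : Matrix (Fin 3) (Fin 3) ℂ) (c : ℝ) (x y : Lam) :
    wmul R (c • x) y = c • wmul R x y := by
  rw [← Complex.coe_smul, wmul_smul_left, Complex.coe_smul]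

section Conv

variable {κ : ℝ} {h k l : ℝ × ℝ → Lam}

theorem continuous_wconv_kernel (κ : ℝ) (hh : Continuous h) (hk : Continuous k) :
    Continuous fun z : (ℝ × ℝ) × (ℝ × ℝ) => Real.exp (-z.2.1 / κ) •
      wmul (rmat κ z.2) (h z.2) (k (gmul κ (ginv κ z.2) z.1)) := by
  have e : Continuous fun z : (ℝ × ℝ) × (ℝ × ℝ) => gmul κ (ginv κ z.2) z.1 :=
    (continuous_gmul κ).comp (((continuous_ginv κ).comp continuous_snd).prodMk continuous_fst)
  refine Continuous.smul (f := fun z : (ℝ × ℝ) × (ℝ × ℝ) => Real.exp (-z.2.1 / κ)) (by fun_prop) ?_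
  exact continuous_wmul ((continuous_rmat κ).comp continuous_snd) (hh.comp continuous_snd)
    (hk.comp e)

theorem integrable_wconv_kernel (κ : ℝ) (hh : IsTest h) (hk : Continuous k) (p : ℝ × ℝ) :
    Integrable fun q : ℝ × ℝ => Real.exp (-q.1 / κ) •
      wmul (rmat κ q) (h q) (k (gmul κ (ginv κ q) p)) := by
  refine Continuous.integrable_of_hasCompactSupport
    ((continuous_wconv_kernel κ hh.smooth.continuous hk).comp (Continuous.prodMk_right p))
    (HasCompactSupport.intro hh.compact fun q hq => ?_)
  rw [image_eq_zero_of_notMem_tsupport hq, wmul_zero_left, smul_zero]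

/-- Expanding in monomials reduces `wconv` to the scalar `conv`, the matrix entries being absorbed
in the first factor. Smoothness, compact support and `starProd_fourier` then carry over from the
scalar case. -/
theorem wconv_eq_sum (hh : IsTest h) (hk : IsTest k) (p : ℝ × ℝ) :
    wconv κ h k p = ∑ I, ∑ J, wordProd gen I fun K =>
      conv κ (fun q => h q I * wordProd (cols (rmat κ q)) J lamOne K) (fun q => k q J) p := by
  have hc := hh.smooth.continuous
  have hi : ∀ I J, Integrable fun q : ℝ × ℝ => Real.exp (-q.1 / κ) •
      ((h q I * k (gmul κ (ginv κ q) p) J) • wordProd (cols (rmat κ q)) J lamOne) := by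
    intro I J
    have e : Continuous fun q : ℝ × ℝ => gmul κ (ginv κ q) p :=
      (continuous_gmul κ).comp ((continuous_ginv κ).prodMk continuous_const)
    refine Continuous.integrable_of_hasCompactSupport ?_
      (HasCompactSupport.intro hh.compact fun q hq => ?_)
    · refine Continuous.smul (f := fun q : ℝ × ℝ => Real.exp (-q.1 / κ)) (by fun_prop)
        (Continuous.smul (f := fun q => h q I * k (gmul κ (ginv κ q) p) J) ?_ ?_)
      · exact ((continuous_apply I).comp hc).mul
          ((continuous_apply J).comp (hk.smooth.continuous.comp e))
      · exact continuous_cols_prod (continuous_rmat κ) continuous_const _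
    · rw [image_eq_zero_of_notMem_tsupport hq]
      simp
  have hs : ∀ (A : Module.End ℂ Lam) (r : ℝ) (x : Lam), r • A x = A (r • x) := fun A r x => by
    rw [← Complex.coe_smul, ← map_smul, Complex.coe_smul]
  simp only [wconv, wmul_eq_sum, Finset.smul_sum, hs]
  rw [integral_finsetSum _ fun I _ => integrable_finsetSum _ fun J _ =>
    integrable_end _ (hi I J), Finset.smul_sum]
  refine Finset.sum_congr rfl fun I _ => ?_
  rw [integral_finsetSum _ fun J _ => integrable_end _ (hi I J), Finset.smul_sum]
  refine Finset.sum_congr rfl fun J _ => ?_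
  rw [integral_end _ (hi I J), ← map_smul]
  congr 1
  ext1 K
  rw [Pi.smul_apply, eval_integral fun K => (integrable_pi_iff.1 (hi I J)) K, smul_eq_mul, conv]
  congr 1
  refine integral_congr_ae (.of_forall fun q => ?_)
  simp only [Pi.smul_apply, Complex.real_smul, smul_eq_mul]
  ring

theorem isTest_conv_aux (hh : IsTest h) (hk : IsTest k) (I J : Finset (Fin 3)) :
    IsTest fun p K =>
      conv κ (fun q => h q I * wordProd (cols (rmat κ q)) J lamOne K) (fun q => k q J) p := by
  have t := (IsTest.single (hh.smooth_apply I) (hh.compact_apply I) lamOne).cols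
    (contDiff_rmat κ) (J.sort (· ≤ ·))
  simp only [map_smul] at t
  exact IsTest.of_apply
    (fun K => contDiff_conv κ (t.smooth_apply K) (t.compact_apply K) (hk.smooth_apply J))
    (fun K => hasCompactSupport_conv κ (t.compact_apply K) (hk.compact_apply J))

theorem IsTest.wconv (hh : IsTest h) (hk : IsTest k) : IsTest (wconv κ h k) := by
  have : KappaMinkowski.wconv κ h k = _ := funext fun p => wconv_eq_sum hh hk p
  rw [this]
  exact IsTest.sum _ fun I => IsTest.sum _ fun J => (isTest_conv_aux hh hk I J).map _

theorem wedge_fourierForm (hh : IsTest h) (hk : IsTest k) :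
    wedge κ (fourierForm h) (fourierForm k) = fourierForm (wconv κ h k) := by
  have e : ∀ I J, wordWedge (I.sort (· ≤ ·)) (fun K => starProd κ
      (funWord κ (J.sort (· ≤ ·)) (fourierForm h I) K) (fourierForm k J)) =
      fourierForm fun p => wordProd gen I fun K => conv κ
        (fun q => h q I * wordProd (cols (rmat κ q)) J lamOne K) (fun q => k q J) p := by
    intro I J
    have t := (IsTest.single (hh.smooth_apply I) (hh.compact_apply I) lamOne).cols
      (contDiff_rmat κ) (J.sort (· ≤ ·))
    simp only [map_smul] at t
    rw [wordProd, ← wordWedge_fourierForm]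
    congr 1
    ext1 K
    conv_lhs => rw [fourierForm, funWord_fourier κ _ (hh.smooth_apply I) (hh.compact_apply I)]
    exact starProd_fourier κ (t.smooth_apply K) (t.compact_apply K) (hk.smooth_apply J)
      (hk.compact_apply J)
  have : wconv κ h k = _ := funext fun p => wconv_eq_sum hh hk p
  rw [this, wedge, fourierForm_sum _ fun I => IsTest.sum _ fun J =>
    (isTest_conv_aux hh hk I J).map _]
  refine Finset.sum_congr rfl fun I _ => ?_
  rw [fourierForm_sum _ fun J => (isTest_conv_aux hh hk I J).map _]
  exact Finset.sum_congr rfl fun J _ => e I J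

theorem wconv_mem {i j : ℕ} (hh : ∀ q, h q ∈ lamDeg i) (hk : ∀ q, k q ∈ lamDeg j)
    (th : IsTest h) (tk : IsTest k) (p : ℝ × ℝ) : wconv κ h k p ∈ lamDeg (i + j) := by
  refine Submodule.smul_mem _ _ fun I hI => ?_
  rw [eval_integral fun K => (integrable_pi_iff.1
    (integrable_wconv_kernel κ th tk.smooth.continuous p)) K]
  refine integral_eq_zero_of_ae (.of_forall fun q => ?_)
  simp only [Pi.smul_apply, wmul_mem (hh q) (hk _) I hI, smul_zero, Pi.zero_apply]

theorem wconv_add_right (hh : IsTest h) (hk : IsTest k) (hl : IsTest l) :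
    wconv κ h (fun q => k q + l q) = fun p => wconv κ h k p + wconv κ h l p := by
  ext1 p
  simp only [wconv, ← wmulRight_apply, map_add, smul_add]
  simp only [wmulRight_apply]
  rw [integral_add (integrable_wconv_kernel κ hh hk.smooth.continuous p)
    (integrable_wconv_kernel κ hh hl.smooth.continuous p), smul_add]

theorem wconv_add_left (hh : IsTest h) (hk : IsTest k) (hl : IsTest l) :
    wconv κ (fun q => h q + k q) l = fun p => wconv κ h l p + wconv κ k l p := by
  ext1 p
  simp only [wconv, ← wmulLeft_apply, map_add, smul_add]
  simp only [wmulLeft_apply]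
  rw [integral_add (integrable_wconv_kernel κ hh hl.smooth.continuous p)
    (integrable_wconv_kernel κ hk hl.smooth.continuous p), smul_add]

theorem wconv_smul_left (c : ℂ) :
    wconv κ (fun q => c • h q) k = fun p => c • wconv κ h k p := by
  ext1 p
  simp only [wconv, wmul_smul_left, smul_comm _ c, integral_smul]

theorem wconv_smul_right (c : ℂ) :
    wconv κ h (fun q => c • k q) = fun p => c • wconv κ h k p := by
  ext1 p
  simp only [wconv, wmul_smul_right, smul_comm _ c, integral_smul]

/-- Multiplication by a character is multiplicative. -/
theorem wconv_twist (γ : ℝ) :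
    wconv κ (fun q => Complex.exp (γ * q.1) • h q) (fun q => Complex.exp (γ * q.1) • k q) =
      fun p => Complex.exp (γ * p.1) • wconv κ h k p := by
  ext1 p
  simp only [wconv, wmul_smul_left, wmul_smul_right]
  rw [smul_comm (Complex.exp _), ← integral_smul (Complex.exp _)]
  congr 1
  refine integral_congr_ae (.of_forall fun q => ?_)
  simp only
  rw [smul_smul, ← Complex.exp_add, smul_comm]
  congr 3
  simp only [gmul, ginv]
  push_cast
  ring

theorem vec_wconv (hκ : κ ≠ 0) (hh : IsTest h) (hk : IsTest k) {i : ℕ}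
    (hd : ∀ q, h q ∈ lamDeg i) (p : ℝ × ℝ) :
    vec (dvec κ p) (wconv κ h k p) = wconv κ (fun q => vec (dvec κ q) (h q)) k p +
      (-1 : ℂ) ^ i • wconv κ h (fun q => vec (dvec κ q) (k q)) p := by
  have t1 := integrable_wconv_kernel κ (hh.vec (contDiff_dvec κ)) hk.smooth.continuous p
  have t2 := integrable_wconv_kernel κ hh (hk.vec (contDiff_dvec κ)).smooth.continuous p
  have t3 := integrable_end ((-1 : ℂ) ^ i • 1) t2
  simp only [LinearMap.smul_apply, Module.End.one_apply] at t3
  simp only [wconv]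
  rw [map_smul, ← integral_end _ (integrable_wconv_kernel κ hh hk.smooth.continuous p),
    smul_comm ((-1 : ℂ) ^ i), ← smul_add, ← integral_smul ((-1 : ℂ) ^ i),
    ← integral_add t1 t3]
  congr 1
  refine integral_congr_ae (.of_forall fun q => ?_)
  simp only
  -- The cocycle identity for the factorisation p = q · (q⁻¹p).
  have e : dvec κ p = dvec κ q + rmat κ q *ᵥ dvec κ (gmul κ (ginv κ q) p) := by
    rw [← dvec_gmul hκ, gmul_ginv_cancel]
  rw [← Complex.coe_smul, map_smul, e, vec_wmul _ _ _ (hd q), smul_add, Complex.coe_smul,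
    Complex.coe_smul, smul_comm ((-1 : ℂ) ^ i)]

theorem wconv_assoc (hκ : κ ≠ 0) (hh : IsTest h) (hk : IsTest k) (hl : IsTest l) :
    wconv κ (wconv κ h k) l = wconv κ h (wconv κ k l) := by
  ext1 p
  have hch := hh.smooth.continuous
  have hck := hk.smooth.continuous
  have hcl := hl.smooth.continuous
  set c : ℂ := 1 / (2 * (Real.pi : ℂ)) with hc
  have lhs : wconv κ (wconv κ h k) l p = c • c • ∫ r : ℝ × ℝ, ∫ q : ℝ × ℝ,
      Real.exp (-r.1 / κ) • Real.exp (-q.1 / κ) •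
        wmul (rmat κ r) (wmul (rmat κ q) (h q) (k (gmul κ (ginv κ q) r))) (l (gmul κ (ginv κ r) p)) := by
    rw [wconv, ← hc]
    congr 1
    rw [← integral_smul c]
    refine integral_congr_ae (.of_forall fun r => ?_)
    simp only [wconv, ← hc, wmul_smul_left]
    rw [smul_comm]
    congr 1
    rw [← wmulLeft_apply, ← integral_end _ (integrable_wconv_kernel κ hh hck r), ← integral_smul (Real.exp (-r.1 / κ))]
    refine integral_congr_ae (.of_forall fun q => ?_)
    simp only
    rw [← Complex.coe_smul (Real.exp (-q.1 / κ)), map_smul, wmulLeft_apply, Complex.coe_smul]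
  have rhs : wconv κ h (wconv κ k l) p = c • c • ∫ q : ℝ × ℝ, ∫ s : ℝ × ℝ,
      Real.exp (-q.1 / κ) • Real.exp (-s.1 / κ) •
        wmul (rmat κ q) (h q) (wmul (rmat κ s) (k s) (l (gmul κ (ginv κ s) (gmul κ (ginv κ q) p)))) := by
    rw [wconv, ← hc]
    congr 1
    rw [← integral_smul c]
    refine integral_congr_ae (.of_forall fun q => ?_)
    simp only [wconv, ← hc, wmul_smul_right]
    rw [smul_comm]
    congr 1
    rw [← wmulRight_apply, ← integral_end _ (integrable_wconv_kernel κ hk hcl _), ← integral_smul (Real.exp (-q.1 / κ))]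
    refine integral_congr_ae (.of_forall fun s => ?_)
    simp only
    rw [← Complex.coe_smul (Real.exp (-s.1 / κ)), map_smul, wmulRight_apply, Complex.coe_smul]
  rw [lhs, rhs, integral_integral_swap_of_hasCompactSupport]
  · congr 2
    refine integral_congr_ae (.of_forall fun q => ?_)
    simp only
    -- After the swap of integrals, substitute r = qs; the Jacobian exp(q.1/κ) combines with the
    -- weights at qs and q into the weights at q and s.
    rw [integral_gmul_left κ q, ← integral_smul]
    refine integral_congr_ae (.of_forall fun s => ?_)
    simp only
    rw [ginv_gmul_cancel, ginv_gmul_rev, rmat_gmul hκ, ← wmul_assoc, gmul_assoc, smul_smul, smul_smul,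
      smul_smul]
    congr 1
    simp only [gmul, ← Real.exp_add]
    congr 1
    ring
  · have e : Continuous fun z : (ℝ × ℝ) × (ℝ × ℝ) => gmul κ (ginv κ z.1) p :=
      (continuous_gmul κ).comp (((continuous_ginv κ).comp continuous_fst).prodMk continuous_const)
    refine Continuous.smul (f := fun z : (ℝ × ℝ) × (ℝ × ℝ) => Real.exp (-z.1.1 / κ)) (by fun_prop) ?_
    have := continuous_wmul ((continuous_rmat κ).comp continuous_fst)
      (continuous_wconv_kernel κ hch hck) (hcl.comp e)
    simp only [wmul_ofReal_smul_left] at this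
    exact this
  -- For a nonzero integrand, q lies in the support of h and s = q⁻¹r in that of k, so (r, q) = (qs,
  -- q) lies in the image of a compact set.
  · refine HasCompactSupport.intro ((hh.compact.isCompact.prod hk.compact.isCompact).image
      (f := fun z : (ℝ × ℝ) × (ℝ × ℝ) => (gmul κ z.1 z.2, z.1))
      ((continuous_gmul κ).prodMk continuous_fst)) fun z hz => ?_
    simp only [Function.uncurry]
    by_cases hq : z.2 ∈ tsupport h
    · have : gmul κ (ginv κ z.2) z.1 ∉ tsupport k := fun hk =>
        hz ⟨(z.2, gmul κ (ginv κ z.2) z.1), ⟨hq, hk⟩, by simp⟩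
      rw [image_eq_zero_of_notMem_tsupport this, wmul_zero_right, wmul_zero_left, smul_zero,
        smul_zero]
    · rw [image_eq_zero_of_notMem_tsupport hq, wmul_zero_left, wmul_zero_left, smul_zero, smul_zero]

theorem wconv_twisted_trace (hκ : κ ≠ 0) (hh : IsTest h) (hk : IsTest k) {i j : ℕ}
    (hij : i + j = 3) (dh : ∀ q, h q ∈ lamDeg i) (dk : ∀ q, k q ∈ lamDeg j) :
    wconv κ h k 0 Finset.univ = (-1 : ℂ) ^ (i * j) *
      wconv κ (fun q => Complex.exp (((1 / κ : ℝ) : ℂ) * q.1) • k q) h 0 Finset.univ := by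
  have tk : IsTest fun q => Complex.exp (((1 / κ : ℝ) : ℂ) * q.1) • k q :=
    hk.mul (contDiff_cexp_fst _)
  simp only [wconv, Pi.smul_apply, smul_eq_mul]
  rw [eval_integral fun K => (integrable_pi_iff.1
      (integrable_wconv_kernel κ hh hk.smooth.continuous 0)) K,
    eval_integral fun K => (integrable_pi_iff.1
      (integrable_wconv_kernel κ tk hh.smooth.continuous 0)) K, mul_left_comm]
  congr 1
  -- After inversion the Jacobian exp(-q.1/κ) cancels the weight exp(q.1/κ) on the left. On the
  -- right the weight exp(-q.1/κ) cancels the twist, so both sides are integrals against plain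
  -- Lebesgue measure.
  rw [integral_ginv κ, ← integral_const_mul]
  refine integral_congr_ae (.of_forall fun q => ?_)
  have e1 : Complex.exp (-q.1 / κ) * Complex.exp (q.1 / κ) = 1 := by
    rw [← Complex.exp_add]; simp [neg_div]
  have e2 : Complex.exp (((1 / κ : ℝ) : ℂ) * q.1) = Complex.exp (q.1 / κ) := by
    congr 1; push_cast; ring
  simp only [gmul_zero, ginv_ginv, Pi.smul_apply, wmul_smul_left, Complex.real_smul, smul_eq_mul, e2]
  rw [wmul_twisted_comm (rmat_mul_ginv hκ q) (rmat_det q) hij (dh _) (dk q)]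
  simp only [ginv, neg_neg]
  push_cast
  ring

end Conv

/-! ### The twisted cycle -/

theorem volForm_of_mem {f : ℝ × ℝ → ℂ} (hf : f ∈ B) : volForm f = Pi.single Finset.univ f := by
  obtain ⟨h, -, -, rfl⟩ := hf
  have hu : [(0 : Fin 3), 1, 2].toFinset = Finset.univ := by decide
  rw [volForm, ofFun_fourier, wordWedge_fourierForm]
  simp only [map_smul, prod_gen_lamOne (L := [(0 : Fin 3), 1, 2]) (by decide), hu]
  ext1 I
  by_cases hI : I = Finset.univ
  · subst hI
    simp [fourierForm]
  · simp [fourierForm, hI]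

theorem mem_Omega_three_iff (η : Form) : η ∈ Omega 3 ↔ ∃ f ∈ B, η = volForm f := by
  constructor
  · intro hη
    refine ⟨η Finset.univ, (hη _).1, ?_⟩
    rw [volForm_of_mem (hη _).1]
    ext1 I
    by_cases hI : I = Finset.univ
    · subst hI; simp
    · rw [Pi.single_eq_of_ne hI]
      exact (hη I).2 fun h => hI (Finset.card_eq_iff_eq_univ I |>.1 (by simpa using h))
  · rintro ⟨f, hf, rfl⟩ I
    rw [volForm_of_mem hf]
    by_cases hI : I = Finset.univ
    · subst hI
      simpa using hf
    · simp [hI, B.zero_mem]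

theorem iSupIndep_Omega : iSupIndep Omega := by
  intro k
  -- Forms of all other degrees have zero coefficients on the index sets of size k.
  have hle : ⨆ j, ⨆ (_ : j ≠ k), Omega j ≤
      Submodule.pi {I : Finset (Fin 3) | I.card = k} fun _ => (⊥ : Submodule ℂ (ℝ × ℝ → ℂ)) :=
    iSup₂_le fun j hj η hη I hI => (hη I).2 fun h => hj (h.symm.trans hI)
  refine Disjoint.mono_right hle (Submodule.disjoint_def.2 fun η h1 h2 => funext fun I => ?_)
  by_cases hI : I.card = k
  · exact h2 I hI
  · exact (h1 I).2 hI

theorem isDGAlgebra {κ : ℝ} (hκ : κ ≠ 0) : IsDGAlgebra Omega (wedge κ) (dForm κ) where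
  indep := iSupIndep_Omega
  mul_mem i j a ha b hb := by
    obtain ⟨h, th, dh, rfl⟩ := mem_Omega_iff.1 ha
    obtain ⟨k, tk, dk, rfl⟩ := mem_Omega_iff.1 hb
    rw [wedge_fourierForm th tk]
    exact mem_Omega_iff.2 ⟨_, th.wconv tk, wconv_mem dh dk th tk, rfl⟩
  mul_add i j a ha b hb c hc := by
    obtain ⟨h, th, -, rfl⟩ := mem_Omega_iff.1 ha
    obtain ⟨k, tk, -, rfl⟩ := mem_Omega_iff.1 hb
    obtain ⟨l, tl, -, rfl⟩ := mem_Omega_iff.1 hc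
    rw [← fourierForm_add tk tl, wedge_fourierForm th tk, wedge_fourierForm th tl,
      wedge_fourierForm th (tk.add tl), wconv_add_right th tk tl,
      fourierForm_add (th.wconv tk) (th.wconv tl)]
  add_mul i j a ha b hb c hc := by
    obtain ⟨h, th, -, rfl⟩ := mem_Omega_iff.1 ha
    obtain ⟨k, tk, -, rfl⟩ := mem_Omega_iff.1 hb
    obtain ⟨l, tl, -, rfl⟩ := mem_Omega_iff.1 hc
    rw [← fourierForm_add th tk, wedge_fourierForm th tl, wedge_fourierForm tk tl,
      wedge_fourierForm (th.add tk) tl, wconv_add_left th tk tl,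
      fourierForm_add (th.wconv tl) (tk.wconv tl)]
  smul_mul i j z a ha b hb := by
    obtain ⟨h, th, -, rfl⟩ := mem_Omega_iff.1 ha
    obtain ⟨k, tk, -, rfl⟩ := mem_Omega_iff.1 hb
    rw [← fourierForm_smul, wedge_fourierForm th tk, wedge_fourierForm (th.mul contDiff_const) tk,
      wconv_smul_left, fourierForm_smul]
  mul_smul i j z a ha b hb := by
    obtain ⟨h, th, -, rfl⟩ := mem_Omega_iff.1 ha
    obtain ⟨k, tk, -, rfl⟩ := mem_Omega_iff.1 hb
    rw [← fourierForm_smul, wedge_fourierForm th tk, wedge_fourierForm th (tk.mul contDiff_const),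
      wconv_smul_right, fourierForm_smul]
  mul_assoc i j m a ha b hb c hc := by
    obtain ⟨h, th, -, rfl⟩ := mem_Omega_iff.1 ha
    obtain ⟨k, tk, -, rfl⟩ := mem_Omega_iff.1 hb
    obtain ⟨l, tl, -, rfl⟩ := mem_Omega_iff.1 hc
    rw [wedge_fourierForm th tk, wedge_fourierForm tk tl, wedge_fourierForm (th.wconv tk) tl,
      wedge_fourierForm th (tk.wconv tl), wconv_assoc hκ th tk tl]
  d_mem i a ha := by
    obtain ⟨h, th, dh, rfl⟩ := mem_Omega_iff.1 ha
    rw [dForm_fourierForm κ th]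
    exact mem_Omega_iff.2 ⟨_, th.vec (contDiff_dvec κ), fun q => vec_mem (dh q) _, rfl⟩
  d_add i a ha b hb := by
    obtain ⟨h, th, -, rfl⟩ := mem_Omega_iff.1 ha
    obtain ⟨k, tk, -, rfl⟩ := mem_Omega_iff.1 hb
    rw [← fourierForm_add th tk, dForm_fourierForm κ th, dForm_fourierForm κ tk,
      dForm_fourierForm κ (th.add tk),
      ← fourierForm_add (th.vec (contDiff_dvec κ)) (tk.vec (contDiff_dvec κ))]
    simp only [map_add]
  d_smul i z a ha := by
    obtain ⟨h, th, -, rfl⟩ := mem_Omega_iff.1 ha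
    rw [← fourierForm_smul, dForm_fourierForm κ th, dForm_fourierForm κ (th.mul contDiff_const),
      ← fourierForm_smul]
    simp only [map_smul]
  d_d i a ha := by
    obtain ⟨h, th, -, rfl⟩ := mem_Omega_iff.1 ha
    rw [dForm_fourierForm κ th, dForm_fourierForm κ (th.vec (contDiff_dvec κ))]
    simp only [vec_vec]
    exact funext fun I => fourier_zero
  leibniz i j a ha b hb := by
    obtain ⟨h, th, dh, rfl⟩ := mem_Omega_iff.1 ha
    obtain ⟨k, tk, -, rfl⟩ := mem_Omega_iff.1 hb
    have th' := th.vec (contDiff_dvec κ)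
    have tk' := tk.vec (contDiff_dvec κ)
    rw [wedge_fourierForm th tk, dForm_fourierForm κ th, dForm_fourierForm κ tk,
      dForm_fourierForm κ (th.wconv tk), wedge_fourierForm th' tk, wedge_fourierForm th tk',
      ← fourierForm_smul, ← fourierForm_add (th'.wconv tk) ((th.wconv tk').mul contDiff_const)]
    simp only [vec_wconv hκ th tk dh]

theorem TForm_mem (γ : ℝ) {k : ℕ} {η : Form} (hη : η ∈ Omega k) : TForm γ η ∈ Omega k := by
  obtain ⟨h, th, dh, rfl⟩ := mem_Omega_iff.1 hη
  rw [TForm_fourierForm γ th]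
  exact mem_Omega_iff.2 ⟨_, th.mul (contDiff_cexp_fst γ),
    fun q => Submodule.smul_mem _ _ (dh q), rfl⟩

theorem TForm_neg_TForm (γ : ℝ) {k : ℕ} {η : Form} (hη : η ∈ Omega k) :
    TForm (-γ) (TForm γ η) = η := by
  obtain ⟨h, th, -, rfl⟩ := mem_Omega_iff.1 hη
  rw [TForm_fourierForm γ th, TForm_fourierForm (-γ) (th.mul (contDiff_cexp_fst γ))]
  simp only [smul_smul, ← Complex.exp_add]
  simp

theorem isDGAutomorphism (κ γ : ℝ) : IsDGAutomorphism Omega (wedge κ) (dForm κ) (TForm γ) where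
  bij k := by
    refine Set.InvOn.bijOn (f' := TForm (-γ)) ⟨fun η hη => TForm_neg_TForm γ hη, fun η hη => ?_⟩
      (fun η hη => TForm_mem γ hη) (fun η hη => TForm_mem (-γ) hη)
    simpa using TForm_neg_TForm (-γ) hη
  map_add i a ha b hb := by
    obtain ⟨h, th, -, rfl⟩ := mem_Omega_iff.1 ha
    obtain ⟨k, tk, -, rfl⟩ := mem_Omega_iff.1 hb
    rw [← fourierForm_add th tk, TForm_fourierForm γ th, TForm_fourierForm γ tk,
      TForm_fourierForm γ (th.add tk), ← fourierForm_add (th.mul (contDiff_cexp_fst γ))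
      (tk.mul (contDiff_cexp_fst γ))]
    simp only [smul_add]
  map_smul i z a ha := by
    obtain ⟨h, th, -, rfl⟩ := mem_Omega_iff.1 ha
    rw [← fourierForm_smul, TForm_fourierForm γ th, TForm_fourierForm γ (th.mul contDiff_const),
      ← fourierForm_smul]
    simp only [smul_comm z]
  map_mul i j a ha b hb := by
    obtain ⟨h, th, -, rfl⟩ := mem_Omega_iff.1 ha
    obtain ⟨k, tk, -, rfl⟩ := mem_Omega_iff.1 hb
    rw [wedge_fourierForm th tk, TForm_fourierForm γ th, TForm_fourierForm γ tk,
      TForm_fourierForm γ (th.wconv tk), wedge_fourierForm (th.mul (contDiff_cexp_fst γ))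
      (tk.mul (contDiff_cexp_fst γ)), wconv_twist]
  map_d i a ha := by
    obtain ⟨h, th, -, rfl⟩ := mem_Omega_iff.1 ha
    rw [dForm_fourierForm κ th, TForm_fourierForm γ th,
      TForm_fourierForm γ (th.vec (contDiff_dvec κ)),
      dForm_fourierForm κ (th.mul (contDiff_cexp_fst γ))]
    simp only [map_smul]

theorem isClosedGradedTwistedTrace {κ : ℝ} (hκ : κ ≠ 0) :
    IsClosedGradedTwistedTrace Omega (wedge κ) (dForm κ) (TForm (1 / κ)) 3 intForm where
  map_add a ha b hb := by
    obtain ⟨h, th, -, rfl⟩ := mem_Omega_iff.1 ha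
    obtain ⟨k, tk, -, rfl⟩ := mem_Omega_iff.1 hb
    rw [← fourierForm_add th tk, intForm_fourierForm th, intForm_fourierForm tk,
      intForm_fourierForm (th.add tk), Pi.add_apply, mul_add]
  map_smul z a ha := by
    obtain ⟨h, th, -, rfl⟩ := mem_Omega_iff.1 ha
    rw [← fourierForm_smul, intForm_fourierForm th, intForm_fourierForm (th.mul contDiff_const),
      Pi.smul_apply, smul_eq_mul, mul_left_comm]
  closed i _ a ha := by
    obtain ⟨h, th, -, rfl⟩ := mem_Omega_iff.1 ha
    -- Closedness: the integral evaluates the symbol at the group identity, where the cocycle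
    -- vanishes.
    rw [dForm_fourierForm κ th, intForm_fourierForm (th.vec (contDiff_dvec κ)), dvec_zero]
    simp [vec]
  twisted_trace i j hij a ha b hb := by
    obtain ⟨h, th, dh, rfl⟩ := mem_Omega_iff.1 ha
    obtain ⟨k, tk, dk, rfl⟩ := mem_Omega_iff.1 hb
    have tk' := tk.mul (contDiff_cexp_fst ((1 / κ : ℝ) : ℂ))
    rw [TForm_fourierForm _ tk, wedge_fourierForm th tk, wedge_fourierForm tk' th,
      intForm_fourierForm (th.wconv tk), intForm_fourierForm (tk'.wconv th),
      wconv_twisted_trace hκ th tk hij dh dk, mul_left_comm]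

theorem wmul_lamOne_lamOne (R : Matrix (Fin 3) (Fin 3) ℂ) : wmul R lamOne lamOne = lamOne := by
  rw [wmul, rmap_lamOne, lmul, extMap_lamOne]
  rfl

/-- Since Λ(R) fixes the unit, the twisted convolution restricts to the group convolution in degree
zero; this identifies Ω⁰ with 𝓑 as an algebra. -/
theorem wconv_lamOne (κ : ℝ) (f g : ℝ × ℝ → ℂ) :
    wconv κ (fun q => f q • lamOne) (fun q => g q • lamOne) = fun p => conv κ f g p • lamOne := by
  ext1 p
  simp only [wconv, conv, wmul_smul_left, wmul_smul_right, wmul_lamOne_lamOne, ← Complex.coe_smul,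
    smul_smul, integral_smul_const]
  simp only [mul_comm]

theorem isTwistedCycleOver {κ : ℝ} (hκ : κ ≠ 0) :
    IsTwistedCycleOver B (starProd κ) (T (1 / κ)) ofFun Omega (wedge κ) (dForm κ)
      (TForm (1 / κ)) 3 intForm where
  dga := isDGAlgebra hκ
  aut := isDGAutomorphism κ (1 / κ)
  trace := isClosedGradedTwistedTrace hκ
  m_mem := by
    rintro _ ⟨h, h1, h2, rfl⟩ _ ⟨k, k1, k2, rfl⟩
    rw [starProd_fourier κ h1 h2 k1 k2]
    exact B_mem (contDiff_conv κ h1 h2 k1) (hasCompactSupport_conv κ h2 k2)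
  ι_bij := by
    refine ⟨fun f hf I => ?_, fun f _ g _ h => Pi.single_injective ∅ h, fun η hη =>
      ⟨η ∅, (hη ∅).1, funext fun I => ?_⟩⟩
    · by_cases hI : I = ∅
      · subst hI
        simpa [ofFun] using hf
      · simp [ofFun, hI, B.zero_mem]
    · by_cases hI : I = ∅
      · subst hI
        simp [ofFun]
      · rw [ofFun, Pi.single_eq_of_ne hI]
        exact ((hη I).2 (Finset.card_ne_zero_of_mem (Finset.nonempty_iff_ne_empty.2 hI).choose_spec)).symm
  ι_add f _ g _ := by
    ext1 I
    by_cases hI : I = ∅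
    · subst hI; simp [ofFun]
    · simp [ofFun, hI]
  ι_smul z f _ := by
    ext1 I
    by_cases hI : I = ∅
    · subst hI; simp [ofFun]
    · simp [ofFun, hI]
  ι_mul := by
    rintro _ ⟨h, h1, h2, rfl⟩ _ ⟨k, k1, k2, rfl⟩
    rw [starProd_fourier κ h1 h2 k1 k2, ofFun_fourier, ofFun_fourier, ofFun_fourier,
      wedge_fourierForm (IsTest.single h1 h2 _) (IsTest.single k1 k2 _), wconv_lamOne]
  τ_mem := by
    rintro _ ⟨h, h1, h2, rfl⟩
    rw [T_fourier h1 h2]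
    exact B_mem ((contDiff_cexp_fst _).mul h1) h2.mul_left
  ι_twist := by
    rintro _ ⟨h, h1, h2, rfl⟩
    rw [T_fourier h1 h2, ofFun_fourier, ofFun_fourier, TForm_fourierForm _ (IsTest.single h1 h2 _)]
    simp only [smul_smul]

end KappaMinkowski
end

theorem mainTheorem1 (κ : ℝ) (hκ : 0 < κ) :
    (∀ f ∈ KappaMinkowski.B, MeasureTheory.Integrable f) ∧
    (∀ ω : KappaMinkowski.Form, ω ∈ KappaMinkowski.Omega 3 ↔
      ∃ f ∈ KappaMinkowski.B, ω = KappaMinkowski.volForm f) ∧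
    (∀ f ∈ KappaMinkowski.B,
      KappaMinkowski.intForm (KappaMinkowski.volForm f) = ∫ p : ℝ × ℝ, f p) ∧
    KappaMinkowski.IsTwistedCycleOver
      KappaMinkowski.B (KappaMinkowski.starProd κ) (KappaMinkowski.T (1 / κ))
      KappaMinkowski.ofFun
      KappaMinkowski.Omega (KappaMinkowski.wedge κ) (KappaMinkowski.dForm κ)
      (KappaMinkowski.TForm (1 / κ)) 3 KappaMinkowski.intForm := by
  refine ⟨?_, KappaMinkowski.mem_Omega_three_iff, fun f hf => ?_,
    KappaMinkowski.isTwistedCycleOver hκ.ne'⟩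
  · rintro _ ⟨h, h1, h2, rfl⟩
    exact KappaMinkowski.integrable_fourier h1 h2
  · rw [KappaMinkowski.volForm_of_mem hf, KappaMinkowski.intForm, Pi.single_eq_same]
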